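/- **Conventions.** All identities are modulo 2-torsion: every group below is tensored with $\mathbb Z[1/2]$; $F^*$ is the multiplicative group of a field $F$, written additively inside tensor products. For a function $f$ of $N$ arguments, $\mathrm{Alt}_N f(x_1,\dots,x_N)=\sum_{\sigma\in S_N}\mathrm{sgn}(\sigma)f(x_{\sigma(1)},\dots,x_{\sigma(N)})$ (no normalization), and $\mathrm{Alt}_{3,3}$ is the analogous sum over $S_3\times S_3$. $\Delta$ is the volume form of the ambient vector space, and $(x\,|\,v_1,v_2,\dots)$ is the configuration obtained from $(v_1,v_2,\dots)$ by projection along the line (or projective point) $x$. **The groups $A_m(F)$.** For $m\ge 0$, $A_m(F)$ is the abelian group generated by the symbols $\langle L;M\rangle=\langle l_0,\dots,l_m;m_0,\dots,m_m\rangle_{A_m}$, one for each generic configuration of $2(m+1)$ points of $\mathbb P^m(F)$, with the relations: (1) $\langle L;M\rangle=0$ if $L$ or $M$ lies in a hyperplane; (2) $\langle \sigma L;M\rangle=\langle L;\sigma M\rangle=\mathrm{sgn}(\sigma)\langle L;M\rangle$ for $\sigma\in S_{m+1}$; (3) $\sum_{i=0}^{m+1}(-1)^i\langle l_0,\dots,\widehat{l_i},\dots,l_{m+1};M\rangle=0$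 for generic points of $\mathbb P^m(F)$, and $\sum_{i=0}^{m+1}(-1)^i\langle l_i\,|\,l_0,\dots,\widehat{l_i},\dots,l_{m+1};m_0,\dots,m_m\rangle=0$ for generic points of $\mathbb P^{m+1}(F)$, and the same two relations with the roles of $L$ and $M$ exchanged; (4) $\langle gL;gM\rangle=\langle L;M\rangle$ for $g\in PGL_{m+1}(F)$. The group $A_0(F)$ is identified with $\mathbb Z$ by $\langle l;m\rangle\mapsto 1$, and $A_1(F)$ with $F^*$ by the cross-ratio $$\langle l_0,l_1;m_0,m_1\rangle\longmapsto \frac{\Delta(l_0,m_0)\,\Delta(l_1,m_1)}{\Delta(l_1,m_0)\,\Delta(l_0,m_1)} .$$ **The maps $\nu$.** The homomorphisms $\nu_{m-1,1}:A_m(F)\to A_{m-1}(F)\otimes F^*$, $m\ge2$, are given for $m=2$ (with values in $A_1(F)\otimes F^*=F^*\otimes F^*$) by $$\nu_{1,1}\langle l_0,l_1,l_2;m_0,m_1,m_2\rangle=-\tfrac18\,\mathrm{Alt}_{3,3}\Bigl(\Delta(m_0,l_1,l_2)\otimes\langle m_0|l_1,l_2;m_1,m_2\rangle_{A_1}+\langle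 l_0|l_1,l_2;m_1,m_2\rangle_{A_1}\otimes\Delta(l_0,m_1,m_2)\Bigr),$$ and for $m>2$ by $$\nu_{m-1,1}\langle L;M\rangle=-\sum_{i,j=0}^m(-1)^{i+j}\langle l_i\,|\,l_0,\dots,\widehat{l_i},\dots,l_m;m_0,\dots,\widehat{m_j},\dots,m_m\rangle_{A_{m-1}}\otimes\Delta(l_i,m_0,\dots,\widehat{m_j},\dots,m_m).$$ The map $\nu_{[m]}:A_m(F)\to\bigotimes^m F^*$ is the iteration $A_m\xrightarrow{\nu_{m-1,1}}A_{m-1}\otimes F^*\xrightarrow{\nu_{m-2,1}\otimes\mathrm{Id}}\cdots\xrightarrow{\nu_{1,1}\otimes\mathrm{Id}}\bigotimes^mF^*$; $\nu_{[1]}$ is the identification $A_1(F)=F^*$, and $\nu_{[0]}$ is the identification $A_0(F)=\mathbb Z$. **The elements.** Let $n\ge1$. Let $G_n$ be the moduli space over $\mathbb Q$ of generic configurations (ordered tuples up to linear automorphisms) of $2n$ vectors in an $n$-dimensional space, $\mathcal O(G_n)^*$ the group of invertible regular functions on it, and $\mathbb Q(G_n)$ its field of rational functions. Let $(l_1,\dots,l_{2n})$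 be the universal configuration, normalized so that $(l_1,\dots,l_n)$ is the standard basis, and let $\Delta=\omega\det$ for any fixed $\omega\in\mathcal O(G_n)^*$ (an arbitrary invertible volume form). Put $$\Lambda_{n-1,1}(l_1,\dots,l_{2n})=\mathrm{Alt}_{2n}\bigl(\langle l_1,\dots,l_n;l_{n+1},\dots,l_{2n}\rangle_{A_{n-1}}\otimes\Delta(l_{n+1},\dots,l_{2n})\bigr)\in A_{n-1}(\mathbb Q(G_n))\otimes\mathbb Q(G_n)^*,$$ $$\mathrm I_n(l_1,\dots,l_{2n})=\mathrm{Alt}_{2n}\bigl(\Delta(l_1,\dots,l_n)\otimes\Delta(l_2,\dots,l_{n+1})\otimes\cdots\otimes\Delta(l_n,\dots,l_{2n-1})\bigr)\in\textstyle\bigotimes^n\mathcal O(G_n)^*.$$ **Theorem.** For every $n\ge1$, with $m_i=l_{n+i}$, one has $$(\nu_{[n-1]}\otimes\mathrm{Id})\bigl(\Lambda_{n-1,1}(l_1,\dots,l_n,m_1,\dots,m_n)\bigr)=(-1)^n(n!)^2\,\mathrm I_n(l_1,\dots,l_n,m_1,\dots,m_n)$$ in $\bigotimes^n\mathbb Q(G_n)^*$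 (modulo 2-torsion, i.e. after tensoring with $\mathbb Z[1/2]$), where the right-hand side is mapped there by $\mathcal O(G_n)^*\subset\mathbb Q(G_n)^*$. -/

import Mathlib

open scoped TensorProduct

noncomputable section

namespace GrassmannianPolylog

/-- The ring `ℤ[1/2]`; extending scalars to it is how one works modulo 2-torsion. -/
def ZHalf : Type := Localization.Away (2 : ℤ)

instance : CommRing ZHalf := inferInstanceAs (CommRing (Localization.Away (2 : ℤ)))

/-- The element `1/2` of `ℤ[1/2]`. -/
def half : ZHalf := IsLocalization.Away.invSelf (S := Localization.Away (2 : ℤ)) (2 : ℤ)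

theorem half_add_half : half + half = 1 := by
  have h := IsLocalization.Away.mul_invSelf (S := Localization.Away (2 : ℤ)) (2 : ℤ)
  rw [map_ofNat] at h
  rw [← two_mul]; exact h

/-- The multiplicative group `Aˣ`, written additively, with scalars extended to `ℤ[1/2]`. -/
def UnitsHalf (A : Type*) [CommRing A] : Type _ := ZHalf ⊗[ℤ] Additive Aˣ

instance (A : Type*) [CommRing A] : AddCommGroup (UnitsHalf A) :=
  inferInstanceAs (AddCommGroup (ZHalf ⊗[ℤ] Additive Aˣ))

instance (A : Type*) [CommRing A] : Module ZHalf (UnitsHalf A) :=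
  inferInstanceAs (Module ZHalf (ZHalf ⊗[ℤ] Additive Aˣ))

/-- The class of a unit. -/
def unitClass {A : Type*} [CommRing A] (x : Aˣ) : UnitsHalf A :=
  (1 : ZHalf) ⊗ₜ[ℤ] Additive.ofMul x

open Classical in
/-- The class of a ring element that is a unit (and, by convention, `0` for non-units; the
definition is only ever used for units). -/
def uclass {A : Type*} [CommRing A] (x : A) : UnitsHalf A :=
  if h : IsUnit x then unitClass h.unit else 0

/-- Functoriality of `UnitsHalf`. -/
def UnitsHalf.map {A B : Type*} [CommRing A] [CommRing B] (f : A →+* B) :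
    UnitsHalf A →ₗ[ZHalf] UnitsHalf B :=
  let φ : ZHalf ⊗[ℤ] Additive Aˣ →ₗ[ZHalf] ZHalf ⊗[ℤ] Additive Bˣ :=
    LinearMap.baseChange ZHalf (MonoidHom.toAdditive (Units.map (f : A →* B))).toIntLinearMap
  { toFun := fun x => φ x
    map_add' := fun x y => φ.map_add x y
    map_smul' := fun r x => φ.map_smul r x }

theorem UnitsHalf.map_unitClass {A B : Type*} [CommRing A] [CommRing B] (f : A →+* B) (x : Aˣ) :
    UnitsHalf.map f (unitClass x) = unitClass (Units.map (f : A →* B) x) := rfl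

theorem eq_zero_of_add_self {U : Type*} [AddCommGroup U] [Module ZHalf U] {x : U}
    (h : x + x = 0) : x = 0 := by
  have : (half + half) • x = 0 := by rw [add_smul, ← smul_add, h, smul_zero]
  rwa [half_add_half, one_smul] at this

theorem unitClass_mul {A : Type*} [CommRing A] (x y : Aˣ) :
    unitClass (x * y) = unitClass x + unitClass y := by
  unfold unitClass
  rw [ofMul_mul, TensorProduct.tmul_add]; rfl

theorem uclass_unit {A : Type*} [CommRing A] (x : Aˣ) : uclass (x : A) = unitClass x := by
  unfold uclass
  rw [dif_pos x.isUnit]; congr 1; ext; rfl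

theorem uclass_mul {A : Type*} [CommRing A] {x y : A} (hx : IsUnit x) (hy : IsUnit y) :
    uclass (x * y) = uclass x + uclass y := by
  obtain ⟨x, rfl⟩ := hx; obtain ⟨y, rfl⟩ := hy
  rw [← Units.val_mul, uclass_unit, uclass_unit, uclass_unit, unitClass_mul]

theorem uclass_one {A : Type*} [CommRing A] : uclass (1 : A) = 0 := by
  have := uclass_mul (A := A) isUnit_one isUnit_one
  simpa using this

theorem uclass_neg_one {A : Type*} [CommRing A] : uclass (-1 : A) = 0 := by
  apply eq_zero_of_add_self
  rw [← uclass_mul (isUnit_one.neg) (isUnit_one.neg)]; simp [uclass_one]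

theorem uclass_neg {A : Type*} [CommRing A] (x : A) : uclass (-x) = uclass x := by
  by_cases hx : IsUnit x
  · rw [← neg_one_mul, uclass_mul isUnit_one.neg hx, uclass_neg_one, zero_add]
  · have : ¬ IsUnit (-x) := by rwa [IsUnit.neg_iff]
    simp [uclass, hx, this]

theorem uclass_inv {F : Type*} [Field F] (x : F) : uclass x⁻¹ = - uclass x := by
  by_cases hx : x = 0
  · subst hx; simp [uclass]
  · rw [eq_neg_iff_add_eq_zero, ← uclass_mul (by simpa using hx) (by simpa using hx),
      inv_mul_cancel₀ hx, uclass_one]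

/-- The coordinate space `A^d`. -/
abbrev Vec (A : Type*) (d : ℕ) : Type _ := Fin d → A

/-- The value of the standard volume form of `A^d` on `d` vectors. -/
def vol {A : Type*} [CommRing A] {d : ℕ} (v : Fin d → Vec A d) : A := Matrix.det (Matrix.of v)

/-- A family of vectors in a `d`-dimensional space is generic if any `k ≤ d` of them are linearly
independent. -/
def Generic {F : Type*} [Field F] {d : ℕ} {ι : Type*} (v : ι → Vec F d) : Prop :=
  ∀ s : Finset ι, s.card ≤ d → LinearIndependent F (fun i : s => v i)

/-- `p` is a projection along the line spanned by `x`, so that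
`p ∘ v` represents the configuration of vectors `(x | v)`. -/
def IsProj {F : Type*} [Field F] {d : ℕ} (x : Vec F (d + 1)) (p : Vec F (d + 1) →ₗ[F] Vec F d) :
    Prop :=
  Function.Surjective p ∧ LinearMap.ker p = Submodule.span F {x}

theorem exists_isProj {F : Type*} [Field F] {d : ℕ} {x : Vec F (d + 1)} (hx : x ≠ 0) :
    ∃ p, IsProj x p := by
  have h1 : Module.finrank F (Vec F (d + 1) ⧸ Submodule.span F {x}) = Module.finrank F (Vec F d) := by
    have := Submodule.finrank_quotient_add_finrank (Submodule.span F {x})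
    rw [finrank_span_singleton hx] at this
    simp at this ⊢
    omega
  let e := LinearEquiv.ofFinrankEq _ _ h1
  refine ⟨e.toLinearMap ∘ₗ (Submodule.span F {x}).mkQ, ?_, ?_⟩
  · exact e.surjective.comp (Submodule.mkQ_surjective _)
  · rw [LinearEquiv.ker_comp, Submodule.ker_mkQ]

open Classical in
/-- A chosen projection `F^(d+1) → F^d` along the line spanned by `x ≠ 0`. -/
def proj {F : Type*} [Field F] {d : ℕ} (x : Vec F (d + 1)) : Vec F (d + 1) →ₗ[F] Vec F d :=
  if h : x ≠ 0 then Classical.choose (exists_isProj h) else 0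

theorem proj_spec {F : Type*} [Field F] {d : ℕ} {x : Vec F (d + 1)} (hx : x ≠ 0) :
    IsProj x (proj x) := by
  unfold proj
  rw [dif_pos hx]; exact Classical.choose_spec (exists_isProj hx)

/-! ### Generic families -/

section
variable {F : Type*} [Field F]

theorem Generic.comp {d : ℕ} {ι κ : Type*} {v : ι → Vec F d} (hv : Generic v) {f : κ → ι}
    (hf : Function.Injective f) : Generic (fun k => v (f k)) := by
  intro s hs
  have h := hv (s.map ⟨f, hf⟩) (by simpa using hs)
  refine h.comp (fun k : s => ⟨f k, by simp⟩) ?_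
  intro a b hab
  simp only [Subtype.mk.injEq] at hab
  exact Subtype.ext (hf hab)

theorem Generic.linearIndependent {d : ℕ} {v : Fin d → Vec F d} (hv : Generic v) :
    LinearIndependent F v := by
  have h := hv Finset.univ (by simp)
  exact h.comp (fun k => ⟨k, Finset.mem_univ k⟩) (fun a b hab => by simpa using hab)

theorem Generic.vol_ne_zero {d : ℕ} {v : Fin d → Vec F d} (hv : Generic v) : vol v ≠ 0 := by
  have h := hv.linearIndependent
  have h2 : LinearIndependent F (Matrix.of v).row := h
  rw [Matrix.linearIndependent_rows_iff_isUnit, Matrix.isUnit_iff_isUnit_det] at h2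
  exact h2.ne_zero

theorem Generic.ne_zero {d : ℕ} {ι : Type*} {v : ι → Vec F (d + 1)} (hv : Generic v) (i : ι) :
    v i ≠ 0 := by
  have h := hv {i} (by simp)
  exact h.ne_zero ⟨i, by simp⟩

theorem Generic.proj {d : ℕ} {ι κ : Type*} {v : ι → Vec F (d + 1)} (hv : Generic v) {i₀ : ι}
    {p : Vec F (d + 1) →ₗ[F] Vec F d} (hp : IsProj (v i₀) p) {f : κ → ι}
    (hf : Function.Injective f) (hi : ∀ k, f k ≠ i₀) : Generic (fun k => p (v (f k))) := by
  classical
  intro s hs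
  have hcard : (insert i₀ (s.map ⟨f, hf⟩)).card ≤ d + 1 :=
    (Finset.card_insert_le _ _).trans (by simpa using hs)
  have h := hv _ hcard
  let g : s → (insert i₀ (s.map ⟨f, hf⟩) : Finset ι) := fun k => ⟨f k, by simp⟩
  have hg : Function.Injective g := by
    intro a b hab
    simp only [g, Subtype.mk.injEq] at hab
    exact Subtype.ext (hf hab)
  have h1 := h.comp g hg
  refine h1.map (f := p) ?_
  rw [hp.2]
  have hd := h.disjoint_span_image (s := Set.range g) (t := {⟨i₀, Finset.mem_insert_self _ _⟩}) (by
    rw [Set.disjoint_singleton_right]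
    rintro ⟨k, hk⟩
    exact hi k (congrArg Subtype.val hk))
  rw [← Set.range_comp, Set.image_singleton] at hd
  exact hd

theorem Generic.smul_equiv {d : ℕ} {ι : Type*} {v : ι → Vec F d} (hv : Generic v)
    (g : Vec F d ≃ₗ[F] Vec F d) (a : ι → Fˣ) : Generic (fun i => a i • g (v i)) := by
  intro s hs
  have h := hv s hs
  have h2 := h.map' g.toLinearMap g.ker
  exact h2.units_smul (fun i : s => a i)

end

/-! ### Determinants -/

section
variable {F : Type*} [Field F]

theorem vol_map {d : ℕ} (g : Vec F d →ₗ[F] Vec F d) (v : Fin d → Vec F d) :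
    vol (fun i => g (v i)) = LinearMap.det g * vol v := by
  have h := (Pi.basisFun F (Fin d)).det_comp g v
  rw [Pi.basisFun_det] at h
  exact h

theorem uclass_vol_perm {d : ℕ} (v : Fin d → Vec F d) (σ : Equiv.Perm (Fin d)) :
    uclass (vol (fun i => v (σ i))) = uclass (vol v) := by
  have : vol (fun i => v (σ i)) = Equiv.Perm.sign σ * vol v := by
    have := Matrix.det_permute σ (Matrix.of v)
    exact this
  rw [this]
  rcases Int.units_eq_one_or (Equiv.Perm.sign σ) with h | h <;> simp [h, uclass_neg]

theorem IsProj.exists_vol {d : ℕ} {x : Vec F (d + 1)} (hx : x ≠ 0)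
    {p : Vec F (d + 1) →ₗ[F] Vec F d} (hp : IsProj x p) :
    ∃ c : F, c ≠ 0 ∧ ∀ v : Fin d → Vec F (d + 1),
      vol (fun i => p (v i)) = c * vol (Fin.cons x v : Fin (d + 1) → Vec F (d + 1)) := by
  obtain ⟨f, hf⟩ : ∃ f : Module.Dual F (Vec F (d + 1)), f x ≠ 0 := by
    by_contra! h
    exact hx ((Module.forall_dual_apply_eq_zero_iff F x).1 h)
  let Φ : Vec F (d + 1) →ₗ[F] Vec F (d + 1) :=
    LinearMap.pi (Fin.cons f (fun i => LinearMap.proj i ∘ₗ p))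
  have hpx : p x = 0 := by
    have : x ∈ LinearMap.ker p := by rw [hp.2]; exact Submodule.mem_span_singleton_self x
    exact this
  have key : ∀ v : Fin d → Vec F (d + 1),
      vol (fun i => p (v i)) = ((f x)⁻¹ * LinearMap.det Φ) *
        vol (Fin.cons x v : Fin (d + 1) → Vec F (d + 1)) := by
    intro v
    rw [mul_assoc, ← vol_map, eq_inv_mul_iff_mul_eq₀ hf]
    unfold vol
    rw [Matrix.det_succ_row_zero, Fin.sum_univ_succ, Finset.sum_eq_zero]
    · simp [Φ]
      left
      congr 1
    · intro j _
      simp [Φ, hpx]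
  refine ⟨_, ?_, key⟩
  intro h0
  choose v hv using fun i : Fin d => hp.1 (Pi.single i 1)
  have h := key v
  rw [h0, zero_mul] at h
  have : vol (fun i => p (v i)) = (1 : F) := by
    simp only [hv]
    unfold vol
    have : Matrix.of (fun i : Fin d => (Pi.single i 1 : Vec F d)) = 1 := by
      ext i j; simp [Matrix.one_apply, Pi.single_apply, eq_comm]
    rw [this, Matrix.det_one]
  rw [this] at h
  exact one_ne_zero h

end

/-! ### The scissors congruence groups -/

/-- Generators: generic configurations of `2(n+1)` points of the projective space `ℙⁿ(F)`, the
points being represented by vectors of `F^(n+1)`. -/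
structure GenPair (F : Type*) [Field F] (n : ℕ) where
  L : Fin (n + 1) → Vec F (n + 1)
  M : Fin (n + 1) → Vec F (n + 1)
  generic : Generic (Sum.elim L M)

section
variable {F : Type*} [Field F]

open Classical in
/-- The generator attached to a generic pair `(L; M)` (it is only ever used for generic pairs). -/
def symb {n : ℕ} (L M : Fin (n + 1) → Vec F (n + 1)) : FreeAbelianGroup (GenPair F n) :=
  if h : Generic (Sum.elim L M) then FreeAbelianGroup.of ⟨L, M, h⟩ else 0

/-- The defining relations of `A_n(F)`: nondegeneracy, skew symmetry, additivity, dual additivity,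
and projective invariance (the vectors matter only up to rescaling, and up to `PGL_{n+1}(F)`).
As the generators are generic configurations, nondegeneracy imposes no condition. In the dual
additivity, `l_0, …, l_{n+1}` and the `m_j` are points of `ℙ^(n+1)(F)`, and the configuration
`(l_i | …)` is represented by the images of the other points under any projection along `l_i`. -/
inductive Rel {n : ℕ} : FreeAbelianGroup (GenPair F n) → Prop
  | nondegenerate (P : GenPair F n)
      (h : ¬ LinearIndependent F P.L ∨ ¬ LinearIndependent F P.M) : Rel (FreeAbelianGroup.of P)
  | skew_left (L M : Fin (n + 1) → Vec F (n + 1)) (h : Generic (Sum.elim L M))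
      (σ : Equiv.Perm (Fin (n + 1))) :
      Rel (symb (fun i => L (σ i)) M - (Equiv.Perm.sign σ : ℤ) • symb L M)
  | skew_right (L M : Fin (n + 1) → Vec F (n + 1)) (h : Generic (Sum.elim L M))
      (σ : Equiv.Perm (Fin (n + 1))) :
      Rel (symb L (fun i => M (σ i)) - (Equiv.Perm.sign σ : ℤ) • symb L M)
  | add_left (L : Fin (n + 2) → Vec F (n + 1)) (M : Fin (n + 1) → Vec F (n + 1))
      (h : Generic (Sum.elim L M)) :
      Rel (∑ i : Fin (n + 2), (-1 : ℤ) ^ (i : ℕ) • symb (fun k => L (i.succAbove k)) M)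
  | add_right (L : Fin (n + 1) → Vec F (n + 1)) (M : Fin (n + 2) → Vec F (n + 1))
      (h : Generic (Sum.elim L M)) :
      Rel (∑ i : Fin (n + 2), (-1 : ℤ) ^ (i : ℕ) • symb L (fun k => M (i.succAbove k)))
  | dual_left (L : Fin (n + 2) → Vec F (n + 2)) (M : Fin (n + 1) → Vec F (n + 2))
      (h : Generic (Sum.elim L M)) (p : Fin (n + 2) → (Vec F (n + 2) →ₗ[F] Vec F (n + 1)))
      (hp : ∀ i, IsProj (L i) (p i)) :
      Rel (∑ i : Fin (n + 2), (-1 : ℤ) ^ (i : ℕ) •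
        symb (fun k => p i (L (i.succAbove k))) (fun k => p i (M k)))
  | dual_right (L : Fin (n + 1) → Vec F (n + 2)) (M : Fin (n + 2) → Vec F (n + 2))
      (h : Generic (Sum.elim L M)) (p : Fin (n + 2) → (Vec F (n + 2) →ₗ[F] Vec F (n + 1)))
      (hp : ∀ i, IsProj (M i) (p i)) :
      Rel (∑ i : Fin (n + 2), (-1 : ℤ) ^ (i : ℕ) •
        symb (fun k => p i (L k)) (fun k => p i (M (i.succAbove k))))
  | proj_inv (L M : Fin (n + 1) → Vec F (n + 1)) (h : Generic (Sum.elim L M))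
      (g : Vec F (n + 1) ≃ₗ[F] Vec F (n + 1)) (a b : Fin (n + 1) → Fˣ) :
      Rel (symb (fun i => a i • g (L i)) (fun i => b i • g (M i)) - symb L M)

variable (F) in
/-- The scissors congruence group `A_n(F)`. -/
def AGroup (n : ℕ) : Type _ :=
  FreeAbelianGroup (GenPair F n) ⧸ AddSubgroup.closure {x : FreeAbelianGroup (GenPair F n) | Rel x}

instance (n : ℕ) : AddCommGroup (AGroup F n) :=
  inferInstanceAs (AddCommGroup (FreeAbelianGroup (GenPair F n) ⧸
    AddSubgroup.closure {x : FreeAbelianGroup (GenPair F n) | Rel x}))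

/-- The quotient map. -/
def AGroup.mk {n : ℕ} : FreeAbelianGroup (GenPair F n) →+ AGroup F n :=
  QuotientAddGroup.mk' _

/-- The element `⟨L; M⟩` of `A_n(F)`. -/
def br {n : ℕ} (L M : Fin (n + 1) → Vec F (n + 1)) : AGroup F n := AGroup.mk (symb L M)

theorem AGroup.mk_rel {n : ℕ} {x : FreeAbelianGroup (GenPair F n)} (h : Rel x) :
    AGroup.mk x = 0 :=
  (QuotientAddGroup.eq_zero_iff x).2 (AddSubgroup.subset_closure h)

/-- The homomorphism out of `A_n(F)` with prescribed values on the generators. -/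
def AGroup.lift {n : ℕ} {B : Type*} [AddCommGroup B]
    (f : (Fin (n + 1) → Vec F (n + 1)) → (Fin (n + 1) → Vec F (n + 1)) → B)
    (hf : ∀ x, Rel x → FreeAbelianGroup.lift (fun P : GenPair F n => f P.L P.M) x = 0) :
    AGroup F n →+ B :=
  QuotientAddGroup.lift _ (FreeAbelianGroup.lift (fun P : GenPair F n => f P.L P.M))
    ((AddSubgroup.closure_le _).2 fun x hx => hf x hx)

theorem lift_symb {n : ℕ} {B : Type*} [AddCommGroup B]
    (f : (Fin (n + 1) → Vec F (n + 1)) → (Fin (n + 1) → Vec F (n + 1)) → B)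
    {L M : Fin (n + 1) → Vec F (n + 1)} (h : Generic (Sum.elim L M)) :
    FreeAbelianGroup.lift (fun P : GenPair F n => f P.L P.M) (symb L M) = f L M := by
  unfold symb
  rw [dif_pos h, FreeAbelianGroup.lift_apply_of]

theorem AGroup.lift_br {n : ℕ} {B : Type*} [AddCommGroup B]
    (f : (Fin (n + 1) → Vec F (n + 1)) → (Fin (n + 1) → Vec F (n + 1)) → B)
    (hf : ∀ x, Rel x → FreeAbelianGroup.lift (fun P : GenPair F n => f P.L P.M) x = 0)
    {L M : Fin (n + 1) → Vec F (n + 1)} (h : Generic (Sum.elim L M)) :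
    AGroup.lift f hf (br L M) = f L M :=
  lift_symb f h

/-! Genericity of the configurations that occur in the relations. -/

theorem Generic.elim_comp {d : ℕ} {α β α' β' : Type*} {L : α → Vec F d} {M : β → Vec F d}
    (h : Generic (Sum.elim L M)) {f : α' → α} {g : β' → β} (hf : Function.Injective f)
    (hg : Function.Injective g) : Generic (Sum.elim (fun i => L (f i)) (fun i => M (g i))) := by
  have := h.comp (f := Sum.map f g) (hf.sumMap hg)
  convert this using 1
  ext (x | x) <;> rfl

theorem Generic.left {d : ℕ} {α β : Type*} {L : α → Vec F d} {M : β → Vec F d}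
    (h : Generic (Sum.elim L M)) : Generic L :=
  h.comp (f := Sum.inl) Sum.inl_injective

theorem Generic.right {d : ℕ} {α β : Type*} {L : α → Vec F d} {M : β → Vec F d}
    (h : Generic (Sum.elim L M)) : Generic M :=
  h.comp (f := Sum.inr) Sum.inr_injective

theorem Generic.comp_left {d : ℕ} {α β α' : Type*} {L : α → Vec F d} {M : β → Vec F d}
    (h : Generic (Sum.elim L M)) {f : α' → α} (hf : Function.Injective f) :
    Generic (Sum.elim (fun i => L (f i)) M) :=
  h.elim_comp (g := id) hf Function.injective_id

theorem Generic.comp_right {d : ℕ} {α β β' : Type*} {L : α → Vec F d} {M : β → Vec F d}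
    (h : Generic (Sum.elim L M)) {g : β' → β} (hg : Function.Injective g) :
    Generic (Sum.elim L (fun i => M (g i))) :=
  h.elim_comp (f := id) Function.injective_id hg

theorem Generic.proj_left {d n : ℕ} {β : Type*} {L : Fin (n + 1) → Vec F (d + 1)}
    {M : β → Vec F (d + 1)} (h : Generic (Sum.elim L M)) {i : Fin (n + 1)}
    {p : Vec F (d + 1) →ₗ[F] Vec F d} (hp : IsProj (L i) p) :
    Generic (Sum.elim (fun k => p (L (i.succAbove k))) (fun k => p (M k))) := by
  have := h.proj (i₀ := Sum.inl i) hp (f := Sum.map i.succAbove id)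
    (Fin.succAbove_right_injective.sumMap Function.injective_id) (by
      rintro (k | k) <;> simp [Fin.succAbove_ne])
  convert this using 1
  ext (x | x) <;> rfl

theorem Generic.swap {d : ℕ} {α β : Type*} {L : α → Vec F d}
    {M : β → Vec F d} (h : Generic (Sum.elim L M)) : Generic (Sum.elim M L) := by
  have := h.comp (f := Sum.swap) Sum.swap_leftInverse.injective
  convert this using 1
  ext (x | x) <;> rfl

theorem Generic.proj_right {d n : ℕ} {α : Type*} {L : α → Vec F (d + 1)}
    {M : Fin (n + 1) → Vec F (d + 1)} (h : Generic (Sum.elim L M)) {i : Fin (n + 1)}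
    {p : Vec F (d + 1) →ₗ[F] Vec F d} (hp : IsProj (M i) p) :
    Generic (Sum.elim (fun k => p (L k)) (fun k => p (M (i.succAbove k)))) :=
  (h.swap.proj_left hp).swap

theorem Generic.smul_equiv_elim {d : ℕ} {α β : Type*} {L : α → Vec F d}
    {M : β → Vec F d} (h : Generic (Sum.elim L M)) (g : Vec F d ≃ₗ[F] Vec F d)
    (a : α → Fˣ) (b : β → Fˣ) :
    Generic (Sum.elim (fun i => a i • g (L i)) (fun i => b i • g (M i))) := by
  have := h.smul_equiv g (Sum.elim a b)
  convert this using 1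
  ext (x | x) <;> rfl

/-- The functions on pairs of tuples that respect the defining relations. -/
structure IsScissors {n : ℕ} {B : Type*} [AddCommGroup B]
    (f : (Fin (n + 1) → Vec F (n + 1)) → (Fin (n + 1) → Vec F (n + 1)) → B) : Prop where
  skew_left : ∀ L M, Generic (Sum.elim L M) → ∀ σ : Equiv.Perm (Fin (n + 1)),
    f (fun i => L (σ i)) M = (Equiv.Perm.sign σ : ℤ) • f L M
  skew_right : ∀ L M, Generic (Sum.elim L M) → ∀ σ : Equiv.Perm (Fin (n + 1)),
    f L (fun i => M (σ i)) = (Equiv.Perm.sign σ : ℤ) • f L M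
  add_left : ∀ (L : Fin (n + 2) → Vec F (n + 1)) (M : Fin (n + 1) → Vec F (n + 1)),
    Generic (Sum.elim L M) →
      ∑ i : Fin (n + 2), (-1 : ℤ) ^ (i : ℕ) • f (fun k => L (i.succAbove k)) M = 0
  add_right : ∀ (L : Fin (n + 1) → Vec F (n + 1)) (M : Fin (n + 2) → Vec F (n + 1)),
    Generic (Sum.elim L M) →
      ∑ i : Fin (n + 2), (-1 : ℤ) ^ (i : ℕ) • f L (fun k => M (i.succAbove k)) = 0
  dual_left : ∀ (L : Fin (n + 2) → Vec F (n + 2)) (M : Fin (n + 1) → Vec F (n + 2)),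
    Generic (Sum.elim L M) → ∀ p : Fin (n + 2) → (Vec F (n + 2) →ₗ[F] Vec F (n + 1)),
      (∀ i, IsProj (L i) (p i)) →
      ∑ i : Fin (n + 2), (-1 : ℤ) ^ (i : ℕ) •
        f (fun k => p i (L (i.succAbove k))) (fun k => p i (M k)) = 0
  dual_right : ∀ (L : Fin (n + 1) → Vec F (n + 2)) (M : Fin (n + 2) → Vec F (n + 2)),
    Generic (Sum.elim L M) → ∀ p : Fin (n + 2) → (Vec F (n + 2) →ₗ[F] Vec F (n + 1)),
      (∀ i, IsProj (M i) (p i)) →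
      ∑ i : Fin (n + 2), (-1 : ℤ) ^ (i : ℕ) •
        f (fun k => p i (L k)) (fun k => p i (M (i.succAbove k))) = 0
  proj_inv : ∀ L M, Generic (Sum.elim L M) → ∀ (g : Vec F (n + 1) ≃ₗ[F] Vec F (n + 1))
    (a b : Fin (n + 1) → Fˣ), f (fun i => a i • g (L i)) (fun i => b i • g (M i)) = f L M

theorem IsScissors.lift_eq_zero {n : ℕ} {B : Type*} [AddCommGroup B]
    {f : (Fin (n + 1) → Vec F (n + 1)) → (Fin (n + 1) → Vec F (n + 1)) → B} (hf : IsScissors f) :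
    ∀ x, Rel x → FreeAbelianGroup.lift (fun P : GenPair F n => f P.L P.M) x = 0 := by
  intro x hx
  cases hx with
  | nondegenerate P h =>
    exact (h.elim (fun h => h P.generic.left.linearIndependent)
      (fun h => h P.generic.right.linearIndependent)).elim
  | skew_left L M h σ =>
    rw [map_sub, map_zsmul, lift_symb f h,
      lift_symb f (h.comp_left σ.injective),
      hf.skew_left L M h, sub_self]
  | skew_right L M h σ =>
    rw [map_sub, map_zsmul, lift_symb f h,
      lift_symb f (h.comp_right σ.injective),
      hf.skew_right L M h, sub_self]
  | add_left L M h =>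
    rw [map_sum, ← hf.add_left L M h]
    refine Finset.sum_congr rfl fun i _ => ?_
    rw [map_zsmul, lift_symb f (h.comp_left Fin.succAbove_right_injective)]
  | add_right L M h =>
    rw [map_sum, ← hf.add_right L M h]
    refine Finset.sum_congr rfl fun i _ => ?_
    rw [map_zsmul, lift_symb f (h.comp_right Fin.succAbove_right_injective)]
  | dual_left L M h p hp =>
    rw [map_sum, ← hf.dual_left L M h p hp]
    refine Finset.sum_congr rfl fun i _ => ?_
    rw [map_zsmul, lift_symb f (h.proj_left (hp i))]
  | dual_right L M h p hp =>
    rw [map_sum, ← hf.dual_right L M h p hp]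
    refine Finset.sum_congr rfl fun i _ => ?_
    rw [map_zsmul, lift_symb f (h.proj_right (hp i))]
  | proj_inv L M h g a b =>
    rw [map_sub, lift_symb f h, lift_symb f (h.smul_equiv_elim g a b), hf.proj_inv L M h, sub_self]

theorem isScissors_br {n : ℕ} : IsScissors (F := F) (n := n) br where
  skew_left L M h σ := by
    have := AGroup.mk_rel (Rel.skew_left L M h σ)
    rwa [map_sub, map_zsmul, sub_eq_zero] at this
  skew_right L M h σ := by
    have := AGroup.mk_rel (Rel.skew_right L M h σ)
    rwa [map_sub, map_zsmul, sub_eq_zero] at this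
  add_left L M h := by
    have := AGroup.mk_rel (Rel.add_left L M h)
    simp only [map_sum, map_zsmul] at this
    exact this
  add_right L M h := by
    have := AGroup.mk_rel (Rel.add_right L M h)
    simp only [map_sum, map_zsmul] at this
    exact this
  dual_left L M h p hp := by
    have := AGroup.mk_rel (Rel.dual_left L M h p hp)
    simp only [map_sum, map_zsmul] at this
    exact this
  dual_right L M h p hp := by
    have := AGroup.mk_rel (Rel.dual_right L M h p hp)
    simp only [map_sum, map_zsmul] at this
    exact this
  proj_inv L M h g a b := by
    have := AGroup.mk_rel (Rel.proj_inv L M h g a b)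
    rwa [map_sub, sub_eq_zero] at this

theorem IsScissors.map {n : ℕ} {B C : Type*} [AddCommGroup B] [AddCommGroup C]
    {f : (Fin (n + 1) → Vec F (n + 1)) → (Fin (n + 1) → Vec F (n + 1)) → B} (hf : IsScissors f)
    (φ : B →+ C) : IsScissors (fun L M => φ (f L M)) where
  skew_left L M h σ := by rw [hf.skew_left L M h, map_zsmul]
  skew_right L M h σ := by rw [hf.skew_right L M h, map_zsmul]
  add_left L M h := by
    simpa only [map_sum, map_zsmul, map_zero] using congrArg φ (hf.add_left L M h)
  add_right L M h := by
    simpa only [map_sum, map_zsmul, map_zero] using congrArg φ (hf.add_right L M h)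
  dual_left L M h p hp := by
    simpa only [map_sum, map_zsmul, map_zero] using congrArg φ (hf.dual_left L M h p hp)
  dual_right L M h p hp := by
    simpa only [map_sum, map_zsmul, map_zero] using congrArg φ (hf.dual_right L M h p hp)
  proj_inv L M h g a b := by rw [hf.proj_inv L M h]

theorem IsScissors.lift_congr {n : ℕ} {B : Type*} [AddCommGroup B]
    {f f' : (Fin (n + 1) → Vec F (n + 1)) → (Fin (n + 1) → Vec F (n + 1)) → B} (hf : IsScissors f)
    (h : ∀ L M, Generic (Sum.elim L M) → f' L M = f L M) :
    ∀ x, Rel x → FreeAbelianGroup.lift (fun P : GenPair F n => f' P.L P.M) x = 0 := by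
  have : (fun P : GenPair F n => f' P.L P.M) = (fun P : GenPair F n => f P.L P.M) := by
    funext P; exact h _ _ P.generic
  rw [this]
  exact hf.lift_eq_zero

/-- The class of a projected configuration does not depend on the projection. -/
theorem br_congr_ker {n : ℕ} {V : Type*} [AddCommGroup V] [Module F V]
    {p q : V →ₗ[F] Vec F (n + 1)} (hp : Function.Surjective p) (hq : Function.Surjective q)
    (hpq : LinearMap.ker p = LinearMap.ker q) {L M : Fin (n + 1) → V}
    (h : Generic (Sum.elim (fun i => p (L i)) (fun i => p (M i)))) (a b : Fin (n + 1) → Fˣ) :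
    br (fun i => a i • q (L i)) (fun i => b i • q (M i)) =
      br (fun i => p (L i)) (fun i => p (M i)) := by
  let g : Vec F (n + 1) ≃ₗ[F] Vec F (n + 1) :=
    (p.quotKerEquivOfSurjective hp).symm ≪≫ₗ Submodule.quotEquivOfEq _ _ hpq ≪≫ₗ
      q.quotKerEquivOfSurjective hq
  have hg : ∀ x, g (p x) = q x := by
    intro x
    have : (p.quotKerEquivOfSurjective hp).symm (p x) = Submodule.Quotient.mk x := by
      rw [LinearEquiv.symm_apply_eq]; rfl
    simp only [g, LinearEquiv.trans_apply, this]
    rfl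
  have := isScissors_br.proj_inv _ _ h g a b
  simpa only [hg] using this

theorem br_congr_ker' {n : ℕ} {V : Type*} [AddCommGroup V] [Module F V]
    {p q : V →ₗ[F] Vec F (n + 1)} (hp : Function.Surjective p) (hq : Function.Surjective q)
    (hpq : LinearMap.ker p = LinearMap.ker q) {L M : Fin (n + 1) → V}
    (h : Generic (Sum.elim (fun i => p (L i)) (fun i => p (M i)))) :
    br (fun i => q (L i)) (fun i => q (M i)) =
      br (fun i => p (L i)) (fun i => p (M i)) := by
  have := br_congr_ker hp hq hpq h (fun _ => 1) (fun _ => 1)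
  simpa only [one_smul] using this

/-- The kernel of a composition of two projections. -/
theorem IsProj.ker_comp {d : ℕ} {x y : Vec F (d + 2)} {p : Vec F (d + 2) →ₗ[F] Vec F (d + 1)}
    {q : Vec F (d + 1) →ₗ[F] Vec F d} (hp : IsProj x p) (hq : IsProj (p y) q) :
    LinearMap.ker (q ∘ₗ p) = Submodule.span F {x} ⊔ Submodule.span F {y} := by
  rw [LinearMap.ker_comp, hq.2, ← Set.image_singleton, ← Submodule.map_span,
    Submodule.comap_map_eq, hp.2, sup_comm]

end

/-! ### Combinatorial identities -/

section
variable {B : Type*} [AddCommGroup B]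

theorem double_sum {n : ℕ} (H : Fin (n + 2) → Fin (n + 1) → B) :
    ∑ k : Fin (n + 2), ∑ i : Fin (n + 1),
        (-1 : ℤ) ^ ((k : ℕ) + (i : ℕ)) • H (k.succAbove i) (i.predAbove k) =
      -∑ a : Fin (n + 2), ∑ b : Fin (n + 1), (-1 : ℤ) ^ ((a : ℕ) + (b : ℕ)) • H a b := by
  rw [← Finset.sum_neg_distrib]
  simp_rw [← Finset.sum_neg_distrib]
  rw [← Fintype.sum_prod_type', ← Fintype.sum_prod_type']
  let e : Fin (n + 2) × Fin (n + 1) → Fin (n + 2) × Fin (n + 1) :=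
    fun x => (x.1.succAbove x.2, x.2.predAbove x.1)
  have he : Function.Involutive e := by
    rintro ⟨k, i⟩
    simp only [e, Fin.succAbove_succAbove_predAbove, Fin.predAbove_predAbove_succAbove]
  refine Fintype.sum_equiv he.toPerm _ _ ?_
  rintro ⟨k, i⟩
  simp only [Function.Involutive.coe_toPerm, e]
  rw [Fin.neg_one_pow_succAbove_add_predAbove, neg_smul, neg_neg]

theorem skew_sum {n : ℕ} (g : Equiv.Perm (Fin (n + 1)) → B)
    (hg : ∀ (π : Equiv.Perm (Fin (n + 1))) (τ : Equiv.Perm (Fin n)),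
      g (π * Equiv.Perm.decomposeFin.symm (0, τ)) = (Equiv.Perm.sign τ : ℤ) • g π)
    (σ : Equiv.Perm (Fin (n + 1))) :
    ∑ i : Fin (n + 1), (-1 : ℤ) ^ (i : ℕ) • g (σ * (Fin.cycleRange i)⁻¹) =
      (Equiv.Perm.sign σ : ℤ) • ∑ i : Fin (n + 1), (-1 : ℤ) ^ (i : ℕ) • g (Fin.cycleRange i)⁻¹ := by
  rw [← Equiv.sum_comp σ (fun i => (-1 : ℤ) ^ (i : ℕ) • g (Fin.cycleRange i)⁻¹), Finset.smul_sum]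
  refine Finset.sum_congr rfl fun i _ => ?_
  set ρ : Equiv.Perm (Fin (n + 1)) := Fin.cycleRange (σ i) * σ * (Fin.cycleRange i)⁻¹ with hρ
  have h0 : ρ 0 = 0 := by
    simp only [hρ, Equiv.Perm.mul_apply]
    have : (Fin.cycleRange i)⁻¹ 0 = i := Fin.cycleRange_symm_zero i
    rw [this, Fin.cycleRange_self]
  obtain ⟨⟨p, τ⟩, hτ⟩ := Equiv.Perm.decomposeFin.symm.surjective ρ
  have hp : p = 0 := by
    rw [← h0, ← hτ, Equiv.Perm.decomposeFin_symm_apply_zero]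
  subst hp
  have h1 : σ * (Fin.cycleRange i)⁻¹ = (Fin.cycleRange (σ i))⁻¹ * ρ := by
    rw [hρ]; group
  have hs : Equiv.Perm.sign τ = Equiv.Perm.sign ρ := by
    rw [← hτ, Equiv.Perm.decomposeFin.symm_sign]; simp
  rw [h1, ← hτ, hg, hs, hρ, smul_smul, smul_smul]
  congr 1
  simp only [map_mul, map_inv, Fin.sign_cycleRange, Int.units_inv_eq_self]
  push_cast
  have h2 : ((-1 : ℤ) ^ (i : ℕ)) * (-1) ^ (i : ℕ) = 1 := by
    rw [← mul_pow]; simp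
  linear_combination ((-1 : ℤ) ^ ((σ i : Fin (n+1)) : ℕ) * (Equiv.Perm.sign σ : ℤ)) * h2

/-- A sum over the ways of singling out one entry of a tuple is skew symmetric, if the summand is
skew symmetric in the remaining entries. -/
theorem skew_sum_tuple {n : ℕ} {X : Type*} (L : Fin (n + 1) → X) (f : X → (Fin n → X) → B)
    (hf : ∀ (π : Equiv.Perm (Fin (n + 1))) (τ : Equiv.Perm (Fin n)),
      f (L (π 0)) (fun k => L (π (τ k).succ)) =
        (Equiv.Perm.sign τ : ℤ) • f (L (π 0)) (fun k => L (π k.succ)))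
    (σ : Equiv.Perm (Fin (n + 1))) :
    ∑ i : Fin (n + 1), (-1 : ℤ) ^ (i : ℕ) • f (L (σ i)) (fun k => L (σ (i.succAbove k))) =
      (Equiv.Perm.sign σ : ℤ) •
        ∑ i : Fin (n + 1), (-1 : ℤ) ^ (i : ℕ) • f (L i) (fun k => L (i.succAbove k)) := by
  have h0 : ∀ i : Fin (n + 1), (Fin.cycleRange i)⁻¹ 0 = i := fun i => Fin.cycleRange_symm_zero i
  have h1 : ∀ (i : Fin (n + 1)) (k : Fin n), (Fin.cycleRange i)⁻¹ k.succ = i.succAbove k :=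
    fun i k => Fin.cycleRange_symm_succ i k
  have := skew_sum (fun π => f (L (π 0)) (fun k => L (π k.succ))) (by
    intro π τ
    rw [← hf]
    simp [Equiv.Perm.mul_apply]) σ
  simpa only [Equiv.Perm.mul_apply, h0, h1] using this

end

/-! ### The component `ν_{n-1,1}` of the coproduct -/

section
variable {F : Type*} [Field F]

theorem tmul_eq_zero_of_add_self {B U : Type*} [AddCommGroup B] [AddCommGroup U] [Module ZHalf U]
    {x : B ⊗[ℤ] U} (h : x + x = 0) : x = 0 := by
  let φ : U →ₗ[ℤ] U := (DistribSMul.toAddMonoidHom U half).toIntLinearMap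
  have hφ : φ + φ = LinearMap.id := by
    ext u
    change half • u + half • u = u
    rw [← add_smul, half_add_half, one_smul]
  have : LinearMap.lTensor B (φ + φ) x = 0 := by
    rw [LinearMap.lTensor_add, LinearMap.add_apply, ← map_add, h, map_zero]
  rwa [hφ, LinearMap.lTensor_id] at this

/-- The element `⟨x | L; M⟩` of `A_n(F)` obtained by projecting along the line spanned by `x`. -/
def brProj {n : ℕ} (x : Vec F (n + 2)) (L M : Fin (n + 1) → Vec F (n + 2)) : AGroup F n :=
  br (fun k => proj x (L k)) (fun k => proj x (M k))

theorem brProj_eq {n : ℕ} {x : Vec F (n + 2)} (hx : x ≠ 0) {L M : Fin (n + 1) → Vec F (n + 2)}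
    {p : Vec F (n + 2) →ₗ[F] Vec F (n + 1)} (hp : IsProj x p)
    (h : Generic (Sum.elim (fun i => p (L i)) (fun i => p (M i)))) :
    brProj x L M = br (fun k => p (L k)) (fun k => p (M k)) :=
  br_congr_ker' hp.1 (proj_spec hx).1 (hp.2.trans (proj_spec hx).2.symm) h

/-- The value of `ν_{n,1} : A_{n+1}(F) → A_n(F) ⊗ Fˣ` on `⟨L; M⟩`. -/
def nuFun {n : ℕ} (L M : Fin (n + 2) → Vec F (n + 2)) : AGroup F n ⊗[ℤ] UnitsHalf F :=
  -∑ i : Fin (n + 2), ∑ j : Fin (n + 2), (-1 : ℤ) ^ ((i : ℕ) + (j : ℕ)) •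
    (brProj (L i) (fun k => L (i.succAbove k)) (fun k => M (j.succAbove k)) ⊗ₜ[ℤ]
      uclass (vol (Fin.cons (L i) (fun k => M (j.succAbove k)) : Fin (n + 2) → Vec F (n + 2))))

theorem nuFun_left {n : ℕ} (L M : Fin (n + 2) → Vec F (n + 2)) :
    nuFun L M = -∑ i : Fin (n + 2), (-1 : ℤ) ^ (i : ℕ) •
      (fun (x : Vec F (n + 2)) (N : Fin (n + 1) → Vec F (n + 2)) =>
        ∑ j : Fin (n + 2), (-1 : ℤ) ^ (j : ℕ) •
        (brProj x N (fun k => M (j.succAbove k)) ⊗ₜ[ℤ]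
          uclass (vol (Fin.cons x (fun k => M (j.succAbove k)) : Fin (n + 2) → Vec F (n + 2)))))
        (L i) (fun k => L (i.succAbove k)) := by
  unfold nuFun
  simp only [Finset.smul_sum, smul_smul, ← pow_add]

theorem nuFun_right {n : ℕ} (L M : Fin (n + 2) → Vec F (n + 2)) :
    nuFun L M = -∑ j : Fin (n + 2), (-1 : ℤ) ^ (j : ℕ) •
      (fun (_ : Vec F (n + 2)) (N : Fin (n + 1) → Vec F (n + 2)) =>
        ∑ i : Fin (n + 2), (-1 : ℤ) ^ (i : ℕ) •
        (brProj (L i) (fun k => L (i.succAbove k)) N ⊗ₜ[ℤ]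
          uclass (vol (Fin.cons (L i) N : Fin (n + 2) → Vec F (n + 2)))))
        (M j) (fun k => M (j.succAbove k)) := by
  unfold nuFun
  rw [Finset.sum_comm]
  simp only [Finset.smul_sum, smul_smul, ← pow_add, add_comm]

theorem generic_left {n : ℕ} {β : Type*} {L : Fin (n + 2) → Vec F (n + 2)} {M : β → Vec F (n + 2)}
    (h : Generic (Sum.elim L M)) (i : Fin (n + 2)) :
    Generic (Sum.elim (fun k => proj (L i) (L (i.succAbove k))) (fun k => proj (L i) (M k))) :=
  h.proj_left (proj_spec (h.left.ne_zero i))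

theorem nuFun_skew_left {n : ℕ} (L M : Fin (n + 2) → Vec F (n + 2)) (h : Generic (Sum.elim L M))
    (σ : Equiv.Perm (Fin (n + 2))) :
    nuFun (fun i => L (σ i)) M = (Equiv.Perm.sign σ : ℤ) • nuFun L M := by
  rw [nuFun_left, nuFun_left, smul_neg]
  congr 1
  refine skew_sum_tuple L (fun (x : Vec F (n + 2)) (N : Fin (n + 1) → Vec F (n + 2)) =>
        ∑ j : Fin (n + 2), (-1 : ℤ) ^ (j : ℕ) •
        (brProj x N (fun k => M (j.succAbove k)) ⊗ₜ[ℤ]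
          uclass (vol (Fin.cons x (fun k => M (j.succAbove k)) :
            Fin (n + 2) → Vec F (n + 2))))) ?_ σ
  intro π τ
  simp only [Finset.smul_sum]
  refine Finset.sum_congr rfl fun j _ => ?_
  rw [smul_comm]
  congr 1
  rw [TensorProduct.smul_tmul']
  congr 1
  have hg := (generic_left (h.comp_left π.injective) 0).comp_right
    (g := j.succAbove) Fin.succAbove_right_injective
  simp only [Fin.zero_succAbove] at hg
  exact isScissors_br.skew_left _ _ hg τ

theorem cons_perm {n : ℕ} (x : Vec F (n + 2)) (N : Fin (n + 1) → Vec F (n + 2))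
    (τ : Equiv.Perm (Fin (n + 1))) :
    uclass (vol (Fin.cons x (fun k => N (τ k)) : Fin (n + 2) → Vec F (n + 2))) =
      uclass (vol (Fin.cons x N : Fin (n + 2) → Vec F (n + 2))) := by
  rw [← uclass_vol_perm (Fin.cons x N : Fin (n + 2) → Vec F (n + 2))
    (Equiv.Perm.decomposeFin.symm (0, τ))]
  congr 2
  funext i
  refine Fin.cases ?_ (fun i => ?_) i <;> simp

theorem nuFun_skew_right {n : ℕ} (L M : Fin (n + 2) → Vec F (n + 2)) (h : Generic (Sum.elim L M))
    (σ : Equiv.Perm (Fin (n + 2))) :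
    nuFun L (fun i => M (σ i)) = (Equiv.Perm.sign σ : ℤ) • nuFun L M := by
  rw [nuFun_right, nuFun_right, smul_neg]
  congr 1
  refine skew_sum_tuple M (fun (_ : Vec F (n + 2)) (N : Fin (n + 1) → Vec F (n + 2)) =>
        ∑ i : Fin (n + 2), (-1 : ℤ) ^ (i : ℕ) •
        (brProj (L i) (fun k => L (i.succAbove k)) N ⊗ₜ[ℤ]
          uclass (vol (Fin.cons (L i) N : Fin (n + 2) → Vec F (n + 2))))) ?_ σ
  intro π τ
  simp only [Finset.smul_sum]
  refine Finset.sum_congr rfl fun i _ => ?_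
  rw [smul_comm]
  congr 1
  rw [TensorProduct.smul_tmul', cons_perm (L i) (fun k => M (π k.succ)) τ]
  congr 1
  have hg := (generic_left h i).comp_right (g := fun k : Fin (n + 1) => π k.succ)
    (π.injective.comp (Fin.succ_injective _))
  exact isScissors_br.skew_right _ _ hg τ

theorem nuFun_add_left {n : ℕ} (L : Fin (n + 3) → Vec F (n + 2)) (M : Fin (n + 2) → Vec F (n + 2))
    (h : Generic (Sum.elim L M)) :
    ∑ i : Fin (n + 3), (-1 : ℤ) ^ (i : ℕ) • nuFun (fun k => L (i.succAbove k)) M = 0 := by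
  have h1 := double_sum (n := n + 1) (fun a b => ∑ j : Fin (n + 2), (-1 : ℤ) ^ (j : ℕ) •
    (brProj (L a) (fun k => L (a.succAbove (b.succAbove k))) (fun k => M (j.succAbove k)) ⊗ₜ[ℤ]
      uclass (vol (Fin.cons (L a) (fun k => M (j.succAbove k)) : Fin (n + 2) → Vec F (n + 2)))))
  simp only [Fin.succAbove_succAbove_succAbove_predAbove] at h1
  simp only [nuFun_left, smul_neg, Finset.sum_neg_distrib]
  simp only [smul_smul, pow_add, mul_assoc, Finset.smul_sum] at h1 ⊢
  rw [h1, neg_neg]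
  refine Finset.sum_eq_zero fun a _ => ?_
  rw [Finset.sum_comm]
  refine Finset.sum_eq_zero fun j _ => ?_
  have hx := proj_spec (h.left.ne_zero a)
  have hg : Generic (Sum.elim (fun k => proj (L a) (L (a.succAbove k)))
      (fun k : Fin (n + 1) => proj (L a) (M (j.succAbove k)))) :=
    (h.proj_left hx).comp_right Fin.succAbove_right_injective
  have h2 := isScissors_br.add_left _ _ hg
  have h3 := congrArg (fun z => (-1 : ℤ) ^ ((a : ℕ) + (j : ℕ)) • (z ⊗ₜ[ℤ]
    uclass (vol (Fin.cons (L a) (fun k => M (j.succAbove k)) : Fin (n + 2) → Vec F (n + 2))))) h2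
  simp only [TensorProduct.zero_tmul, smul_zero, TensorProduct.sum_tmul, Finset.smul_sum,
    ← TensorProduct.smul_tmul', smul_smul] at h3
  rw [← h3]
  refine Finset.sum_congr rfl fun b _ => ?_
  rw [pow_add]
  congr 1
  ring

theorem nuFun_add_right {n : ℕ} (L : Fin (n + 2) → Vec F (n + 2)) (M : Fin (n + 3) → Vec F (n + 2)) :
    ∑ i : Fin (n + 3), (-1 : ℤ) ^ (i : ℕ) • nuFun L (fun k => M (i.succAbove k)) = 0 := by
  have h1 := double_sum (n := n + 1) (fun a b => ∑ i : Fin (n + 2), (-1 : ℤ) ^ (i : ℕ) •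
    (brProj (L i) (fun k => L (i.succAbove k)) (fun k => M (a.succAbove (b.succAbove k))) ⊗ₜ[ℤ]
      uclass (vol (Fin.cons (L i) (fun k => M (a.succAbove (b.succAbove k))) :
        Fin (n + 2) → Vec F (n + 2)))))
  simp only [Fin.succAbove_succAbove_succAbove_predAbove] at h1
  have h2 := tmul_eq_zero_of_add_self (eq_neg_iff_add_eq_zero.1 h1)
  simp only [nuFun_right, smul_neg, Finset.sum_neg_distrib, neg_eq_zero]
  rw [← h2]
  simp only [Finset.smul_sum, smul_smul, pow_add, mul_assoc]

theorem nuFun_aux {n : ℕ} {L M : Fin (n + 2) → Vec F (n + 2)} (h : Generic (Sum.elim L M))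
    (x y : Fin (n + 2) → UnitsHalf F) :
    ∑ i : Fin (n + 2), ∑ j : Fin (n + 2), (-1 : ℤ) ^ ((i : ℕ) + (j : ℕ)) •
      (brProj (L i) (fun k => L (i.succAbove k)) (fun k => M (j.succAbove k)) ⊗ₜ[ℤ] (x i + y j)) =
      0 := by
  simp only [TensorProduct.tmul_add, smul_add, Finset.sum_add_distrib]
  have h1 : ∑ i : Fin (n + 2), ∑ j : Fin (n + 2), (-1 : ℤ) ^ ((i : ℕ) + (j : ℕ)) •
      (brProj (L i) (fun k => L (i.succAbove k)) (fun k => M (j.succAbove k)) ⊗ₜ[ℤ] x i) = 0 := by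
    refine Finset.sum_eq_zero fun i _ => ?_
    have h2 := isScissors_br.add_right _ _ (generic_left h i)
    have h3 := congrArg (fun z => (-1 : ℤ) ^ (i : ℕ) • (z ⊗ₜ[ℤ] x i)) h2
    simp only [TensorProduct.zero_tmul, smul_zero, TensorProduct.sum_tmul, Finset.smul_sum,
      ← TensorProduct.smul_tmul', smul_smul, ← pow_add] at h3
    exact h3
  have h2 : ∑ i : Fin (n + 2), ∑ j : Fin (n + 2), (-1 : ℤ) ^ ((i : ℕ) + (j : ℕ)) •
      (brProj (L i) (fun k => L (i.succAbove k)) (fun k => M (j.succAbove k)) ⊗ₜ[ℤ] y j) = 0 := by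
    rw [Finset.sum_comm]
    refine Finset.sum_eq_zero fun j _ => ?_
    have h2 := isScissors_br.dual_left _ _ (h.comp_right (g := j.succAbove)
      Fin.succAbove_right_injective) (fun i => proj (L i)) (fun i => proj_spec (h.left.ne_zero i))
    have h3 := congrArg (fun z => (-1 : ℤ) ^ (j : ℕ) • (z ⊗ₜ[ℤ] y j)) h2
    simp only [TensorProduct.zero_tmul, smul_zero, TensorProduct.sum_tmul, Finset.smul_sum,
      ← TensorProduct.smul_tmul', smul_smul, ← pow_add] at h3
    rw [← h3]
    refine Finset.sum_congr rfl fun i _ => ?_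
    rw [add_comm]
    rfl
  rw [h1, h2, add_zero]

theorem nuFun_eq_of {n : ℕ} {L M : Fin (n + 2) → Vec F (n + 2)} (h : Generic (Sum.elim L M))
    (x y : Fin (n + 2) → UnitsHalf F) (w : Fin (n + 2) → Fin (n + 2) → UnitsHalf F)
    (hw : ∀ i j, uclass (vol (Fin.cons (L i) (fun k => M (j.succAbove k)) :
      Fin (n + 2) → Vec F (n + 2))) = x i + y j + w i j) :
    nuFun L M = -∑ i : Fin (n + 2), ∑ j : Fin (n + 2), (-1 : ℤ) ^ ((i : ℕ) + (j : ℕ)) •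
      (brProj (L i) (fun k => L (i.succAbove k)) (fun k => M (j.succAbove k)) ⊗ₜ[ℤ] w i j) := by
  unfold nuFun
  simp only [hw]
  have h0 := nuFun_aux h x y
  simp only [TensorProduct.tmul_add _ (_ + _), smul_add, Finset.sum_add_distrib] at h0 ⊢
  simp only [TensorProduct.tmul_add, smul_add, Finset.sum_add_distrib] at h0 ⊢
  rw [h0, zero_add]

theorem uclass_vol_smul {d : ℕ} (a : Fin d → Fˣ) (v : Fin d → Vec F d) :
    vol (fun i => a i • v i) = (∏ i, (a i : F)) * vol v := by
  exact Matrix.det_mul_column (fun i => (a i : F)) (Matrix.of v)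

theorem generic_cons {n : ℕ} {β : Type*} {L : β → Vec F (n + 2)} {M : Fin (n + 2) → Vec F (n + 2)}
    (h : Generic (Sum.elim L M)) (i : β) (j : Fin (n + 2)) :
    vol (Fin.cons (L i) (fun k => M (j.succAbove k)) : Fin (n + 2) → Vec F (n + 2)) ≠ 0 := by
  have := h.comp (f := (Fin.cons (Sum.inl i) (fun k => Sum.inr (j.succAbove k)) :
    Fin (n + 2) → β ⊕ Fin (n + 2))) (by
      rw [Fin.cons_injective_iff]
      exact ⟨by simp, Sum.inr_injective.comp Fin.succAbove_right_injective⟩)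
  convert this.vol_ne_zero using 2
  funext t
  refine Fin.cases ?_ (fun t => ?_) t <;> simp

theorem brProj_smul {n : ℕ} {x : Vec F (n + 2)} (hx : x ≠ 0)
    (g : Vec F (n + 2) ≃ₗ[F] Vec F (n + 2)) (c : Fˣ) {L M : Fin (n + 1) → Vec F (n + 2)}
    (h : Generic (Sum.elim (fun k => proj x (L k)) (fun k => proj x (M k))))
    (a b : Fin (n + 1) → Fˣ) :
    brProj (c • g x) (fun k => a k • g (L k)) (fun k => b k • g (M k)) = brProj x L M := by
  have hx' : c • g x ≠ 0 := by
    rw [Units.smul_def, smul_ne_zero_iff]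
    exact ⟨c.ne_zero, by simpa using hx⟩
  have hs := proj_spec hx
  have hs' := proj_spec hx'
  have hk : LinearMap.ker (proj x) = LinearMap.ker (proj (c • g x) ∘ₗ g.toLinearMap) := by
    rw [LinearMap.ker_comp, hs'.2, hs.2, Units.smul_def,
      Submodule.span_singleton_smul_eq c.isUnit]
    ext y
    rw [Submodule.mem_comap, Submodule.mem_span_singleton, Submodule.mem_span_singleton]
    refine exists_congr fun t => ?_
    rw [LinearEquiv.coe_coe, ← map_smul, g.injective.eq_iff]
  have e := br_congr_ker hs.1 (q := proj (c • g x) ∘ₗ g.toLinearMap)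
    (hs'.1.comp g.surjective) hk h a b
  rw [brProj, brProj, ← e]
  simp only [Units.smul_def, map_smul, LinearMap.comp_apply, LinearEquiv.coe_coe]

theorem nuFun_proj_inv {n : ℕ} (L M : Fin (n + 2) → Vec F (n + 2)) (h : Generic (Sum.elim L M))
    (g : Vec F (n + 2) ≃ₗ[F] Vec F (n + 2)) (a b : Fin (n + 2) → Fˣ) :
    nuFun (fun i => a i • g (L i)) (fun i => b i • g (M i)) = nuFun L M := by
  rw [nuFun_eq_of (h.smul_equiv_elim g a b)
    (fun i => uclass (a i : F) + uclass (LinearMap.det g.toLinearMap))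
    (fun j => uclass (∏ k, (b (j.succAbove k) : F)))
    (fun i j => uclass (vol (Fin.cons (L i) (fun k => M (j.succAbove k)) :
      Fin (n + 2) → Vec F (n + 2))))]
  · rw [nuFun, neg_inj]
    refine Finset.sum_congr rfl fun i _ => Finset.sum_congr rfl fun j _ => ?_
    have key := brProj_smul (h.left.ne_zero i) g (a i)
      (L := fun k => L (i.succAbove k)) (M := fun k => M (j.succAbove k))
      ((generic_left h i).comp_right (g := j.succAbove) Fin.succAbove_right_injective)
      (fun k => a (i.succAbove k)) (fun k => b (j.succAbove k))
    rw [key]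
  · intro i j
    have e : (Fin.cons (a i • g (L i)) (fun k => b (j.succAbove k) • g (M (j.succAbove k))) :
        Fin (n + 2) → Vec F (n + 2)) = fun t =>
        (Fin.cons (a i) (fun k => b (j.succAbove k)) : Fin (n + 2) → Fˣ) t •
          g.toLinearMap ((Fin.cons (L i) (fun k => M (j.succAbove k)) :
            Fin (n + 2) → Vec F (n + 2)) t) := by
      funext t
      refine Fin.cases ?_ (fun t => ?_) t <;> simp
    rw [e, uclass_vol_smul, vol_map, Fin.prod_univ_succ]
    simp only [Fin.cons_zero, Fin.cons_succ]
    have h1 : IsUnit (LinearMap.det g.toLinearMap) := LinearEquiv.isUnit_det' g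
    have h2 : IsUnit (∏ k, (b (j.succAbove k) : F)) := by
      rw [← Units.coe_prod]; exact Units.isUnit _
    have h3 := (generic_cons h i j).isUnit
    rw [uclass_mul ((a i).isUnit.mul h2) (h1.mul h3), uclass_mul (a i).isUnit h2,
      uclass_mul h1 h3]
    abel

theorem brProj_comp_eq {n : ℕ} {x y x' y' : Vec F (n + 3)}
    {p p' : Vec F (n + 3) →ₗ[F] Vec F (n + 2)} (hp : IsProj x p) (hp' : IsProj x' p')
    (hy : p y ≠ 0) (hy' : p' y' ≠ 0)
    (hs : Submodule.span F {x} ⊔ Submodule.span F {y} =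
      Submodule.span F {x'} ⊔ Submodule.span F {y'})
    {N N' : Fin (n + 1) → Vec F (n + 3)}
    (hg : Generic (Sum.elim (fun k => proj (p y) (p (N k))) (fun k => proj (p y) (p (N' k))))) :
    brProj (p' y') (fun k => p' (N k)) (fun k => p' (N' k)) =
      brProj (p y) (fun k => p (N k)) (fun k => p (N' k)) := by
  have h1 := proj_spec hy
  have h2 := proj_spec hy'
  exact br_congr_ker' (p := proj (p y) ∘ₗ p) (q := proj (p' y') ∘ₗ p')
    (h1.1.comp hp.1) (h2.1.comp hp'.1) (by rw [hp.ker_comp h1, hp'.ker_comp h2, hs]) hg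

theorem map_cons {d e m : ℕ} (p : Vec F d →ₗ[F] Vec F e) (x : Vec F d) (N : Fin m → Vec F d) :
    (Fin.cons (p x) (fun k => p (N k)) : Fin (m + 1) → Vec F e) =
      fun t => p ((Fin.cons x N : Fin (m + 1) → Vec F d) t) := by
  funext t
  refine Fin.cases ?_ (fun t => ?_) t <;> simp

theorem cons_cons_swap {n : ℕ} (x y : Vec F (n + 2)) (N : Fin n → Vec F (n + 2)) :
    uclass (vol (Fin.cons x (Fin.cons y N : Fin (n + 1) → Vec F (n + 2)) :
      Fin (n + 2) → Vec F (n + 2))) =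
    uclass (vol (Fin.cons y (Fin.cons x N : Fin (n + 1) → Vec F (n + 2)) :
      Fin (n + 2) → Vec F (n + 2))) := by
  rw [← uclass_vol_perm _ (Equiv.swap 0 1)]
  congr 2
  funext t
  refine Fin.cases ?_ (fun t => Fin.cases ?_ (fun t => ?_) t) t
  · simp
  · simp
  · rw [Equiv.swap_apply_of_ne_of_ne (by simp [Fin.ext_iff]) (by simp [Fin.ext_iff])]
    simp

theorem cons_cons_succAbove {n : ℕ} (x : Vec F (n + 2)) (N : Fin (n + 1) → Vec F (n + 2))
    (b : Fin (n + 1)) :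
    uclass (vol (Fin.cons x (Fin.cons (N b) (fun k => N (b.succAbove k)) :
      Fin (n + 1) → Vec F (n + 2)) : Fin (n + 2) → Vec F (n + 2))) =
    uclass (vol (Fin.cons x N : Fin (n + 2) → Vec F (n + 2))) := by
  rw [← cons_perm x N (Fin.cycleRange b)⁻¹]
  congr 3
  funext t
  refine Fin.cases ?_ (fun t => ?_) t
  · exact congrArg N (Fin.cycleRange_symm_zero b).symm
  · exact congrArg N (Fin.cycleRange_symm_succ b t).symm

theorem nuFun_dual_left {n : ℕ} (L : Fin (n + 3) → Vec F (n + 3)) (M : Fin (n + 2) → Vec F (n + 3))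
    (h : Generic (Sum.elim L M)) (p : Fin (n + 3) → (Vec F (n + 3) →ₗ[F] Vec F (n + 2)))
    (hp : ∀ i, IsProj (L i) (p i)) :
    ∑ i : Fin (n + 3), (-1 : ℤ) ^ (i : ℕ) •
      nuFun (fun k => p i (L (i.succAbove k))) (fun k => p i (M k)) = 0 := by
  choose c hc0 hc using fun k => (hp k).exists_vol (h.left.ne_zero k)
  let w : Fin (n + 3) → Fin (n + 2) → Fin (n + 2) → UnitsHalf F := fun k i j =>
    uclass (vol (Fin.cons (L k) (Fin.cons (L (k.succAbove i)) (fun t => M (j.succAbove t)) :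
      Fin (n + 2) → Vec F (n + 3)) : Fin (n + 3) → Vec F (n + 3)))
  let H : Fin (n + 3) → Fin (n + 2) → AGroup F n ⊗[ℤ] UnitsHalf F := fun k i =>
    ∑ j : Fin (n + 2), (-1 : ℤ) ^ (j : ℕ) •
      (brProj (p k (L (k.succAbove i))) (fun t => p k (L (k.succAbove (i.succAbove t))))
        (fun t => p k (M (j.succAbove t))) ⊗ₜ[ℤ] w k i j)
  have h1 : ∀ k, nuFun (fun t => p k (L (k.succAbove t))) (fun t => p k (M t)) =
      -∑ i : Fin (n + 2), (-1 : ℤ) ^ (i : ℕ) • H k i := by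
    intro k
    have hgk := h.proj_left (hp k)
    rw [nuFun_eq_of hgk (fun _ => uclass (c k)) (fun _ => 0) (w k)]
    · simp only [H, Finset.smul_sum, smul_smul, pow_add]
    · intro i j
      have hv := generic_cons hgk i j
      rw [map_cons, hc k] at hv ⊢
      rw [uclass_mul (hc0 k).isUnit (right_ne_zero_of_mul hv).isUnit, add_zero]
  have h2 : ∀ k i, H (k.succAbove i) (i.predAbove k) = H k i := by
    intro k i
    simp only [H, w, Fin.succAbove_succAbove_succAbove_predAbove,
      Fin.succAbove_succAbove_predAbove]
    refine Finset.sum_congr rfl fun j _ => ?_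
    rw [cons_cons_swap]
    congr 2
    have hgk := h.proj_left (hp k)
    have hgk' := h.proj_left (hp (k.succAbove i))
    have hne := hgk'.left.ne_zero (i.predAbove k)
    rw [Fin.succAbove_succAbove_predAbove] at hne
    exact brProj_comp_eq (hp k) (hp _) (hgk.left.ne_zero i) hne (sup_comm _ _)
      ((generic_left hgk i).comp_right Fin.succAbove_right_injective)
  have h3 := double_sum H
  simp only [h2] at h3
  have h4 := tmul_eq_zero_of_add_self (eq_neg_iff_add_eq_zero.1 h3)
  simp only [h1, smul_neg, Finset.sum_neg_distrib, Finset.smul_sum, smul_smul, ← pow_add]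
  rw [h4, neg_zero]

theorem nuFun_dual_right {n : ℕ} (L : Fin (n + 2) → Vec F (n + 3)) (M : Fin (n + 3) → Vec F (n + 3))
    (h : Generic (Sum.elim L M)) (p : Fin (n + 3) → (Vec F (n + 3) →ₗ[F] Vec F (n + 2)))
    (hp : ∀ i, IsProj (M i) (p i)) :
    ∑ i : Fin (n + 3), (-1 : ℤ) ^ (i : ℕ) •
      nuFun (fun k => p i (L k)) (fun k => p i (M (i.succAbove k))) = 0 := by
  choose c hc0 hc using fun k => (hp k).exists_vol (h.right.ne_zero k)
  have hq : ∀ i, IsProj (L i) (proj (L i)) := fun i => proj_spec (h.left.ne_zero i)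
  let w : Fin (n + 2) → Fin (n + 3) → UnitsHalf F := fun i a =>
    uclass (vol (Fin.cons (L i) (fun t => M (a.succAbove t)) : Fin (n + 3) → Vec F (n + 3)))
  let H : Fin (n + 3) → Fin (n + 2) → AGroup F n ⊗[ℤ] UnitsHalf F := fun a b =>
    ∑ i : Fin (n + 2), (-1 : ℤ) ^ (i : ℕ) •
      (brProj (proj (L i) (M (a.succAbove b))) (fun t => proj (L i) (L (i.succAbove t)))
        (fun t => proj (L i) (M (a.succAbove (b.succAbove t)))) ⊗ₜ[ℤ] w i a)
  have h1 : ∀ k, nuFun (fun t => p k (L t)) (fun t => p k (M (k.succAbove t))) =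
      -∑ j : Fin (n + 2), (-1 : ℤ) ^ (j : ℕ) • H (k.succAbove j) (j.predAbove k) := by
    intro k
    have hgk := h.proj_right (hp k)
    rw [nuFun_eq_of hgk (fun _ => uclass (c k)) (fun _ => 0)
      (fun i j => w i (k.succAbove j))]
    · rw [Finset.sum_comm]
      simp only [H, Finset.smul_sum, smul_smul, Fin.succAbove_succAbove_succAbove_predAbove,
        Fin.succAbove_succAbove_predAbove]
      refine congrArg Neg.neg ?_
      refine Finset.sum_congr rfl fun j _ => Finset.sum_congr rfl fun i _ => ?_
      rw [add_comm (i : ℕ), pow_add]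
      have hgi := h.proj_left (hq i)
      have key := brProj_comp_eq (hq i) (hp k) (hgi.right.ne_zero k) (hgk.left.ne_zero i) (sup_comm _ _)
        (N := fun t => L (i.succAbove t)) (N' := fun t => M (k.succAbove (j.succAbove t)))
        ((hgi.proj_right (proj_spec (hgi.right.ne_zero k))).comp_right (g := j.succAbove)
          Fin.succAbove_right_injective)
      rw [key]
    · intro i j
      have hv := generic_cons hgk i j
      rw [map_cons, hc k] at hv ⊢
      rw [uclass_mul (hc0 k).isUnit (right_ne_zero_of_mul hv).isUnit, add_zero, cons_cons_swap]
      have := cons_cons_succAbove (L i) (fun t => M ((k.succAbove j).succAbove t)) (j.predAbove k)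
      simp only [Fin.succAbove_succAbove_succAbove_predAbove,
        Fin.succAbove_succAbove_predAbove] at this
      rw [this]
  have h3 := double_sum H
  simp only [h1, smul_neg, Finset.sum_neg_distrib]
  simp only [Finset.smul_sum (s := (Finset.univ : Finset (Fin (n + 2)))), smul_smul, ← pow_add]
    at h3 ⊢
  rw [h3, neg_neg]
  refine Finset.sum_eq_zero fun a _ => ?_
  simp only [H, Finset.smul_sum, smul_smul]
  rw [Finset.sum_comm]
  refine Finset.sum_eq_zero fun i _ => ?_
  have hgi := (h.proj_left (hq i)).comp_right (g := a.succAbove) Fin.succAbove_right_injective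
  have h5 := isScissors_br.dual_right _ _ hgi _ (fun b => proj_spec (hgi.right.ne_zero b))
  have h6 := congrArg (fun z => (-1 : ℤ) ^ ((a : ℕ) + (i : ℕ)) • (z ⊗ₜ[ℤ] w i a)) h5
  simp only [TensorProduct.zero_tmul, smul_zero, TensorProduct.sum_tmul, Finset.smul_sum,
    ← TensorProduct.smul_tmul', smul_smul] at h6
  rw [← h6]
  refine Finset.sum_congr rfl fun b _ => ?_
  rw [pow_add, pow_add]
  congr 1
  ring

theorem isScissors_nuFun {n : ℕ} : IsScissors (F := F) (n := n + 1) nuFun where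
  skew_left := nuFun_skew_left
  skew_right := nuFun_skew_right
  add_left := nuFun_add_left
  add_right L M _ := nuFun_add_right L M
  dual_left := nuFun_dual_left
  dual_right := nuFun_dual_right
  proj_inv := nuFun_proj_inv

/-- The map `ν_{n,1} : A_{n+1}(F) → A_n(F) ⊗ Fˣ`, modulo 2-torsion. -/
def nu {n : ℕ} : AGroup F (n + 1) →+ AGroup F n ⊗[ℤ] UnitsHalf F :=
  AGroup.lift nuFun isScissors_nuFun.lift_eq_zero

end

/-! ### The cross-ratio -/

section
variable {F : Type*} [Field F]

/-- The cross-ratio `r(x₁,x₂,x₃,x₄)` of four points of the projective line, represented by vectors;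
for `xᵢ = (tᵢ, 1)` it is `(t₃-t₁)(t₄-t₂) / ((t₃-t₂)(t₄-t₁))`. -/
def crossRatio (x₁ x₂ x₃ x₄ : Vec F 2) : F :=
  (vol ![x₁, x₃] * vol ![x₂, x₄]) / (vol ![x₂, x₃] * vol ![x₁, x₄])

/-- The value of `a₁ : A_1(F) → Fˣ` on `⟨L; M⟩`. -/
def a1Fun (L M : Fin 2 → Vec F 2) : UnitsHalf F :=
  uclass (crossRatio (L 0) (L 1) (M 0) (M 1))

/-- The class of the volume of two vectors of the plane. -/
def e2 (x y : Vec F 2) : UnitsHalf F := uclass (vol ![x, y])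

/-- The class of the volume of three vectors of three-space. -/
def e3 (x y z : Vec F 3) : UnitsHalf F := uclass (vol ![x, y, z])

theorem e2_ne {ι κ : Type*} {L : ι → Vec F 2} {M : κ → Vec F 2} (h : Generic (Sum.elim L M))
    (i : ι) (j : κ) : vol ![L i, M j] ≠ 0 := by
  have := h.comp (f := (![Sum.inl i, Sum.inr j] : Fin 2 → ι ⊕ κ)) (by
    intro a b
    fin_cases a <;> fin_cases b <;> simp)
  convert this.vol_ne_zero using 2
  funext t
  fin_cases t <;> rfl

theorem a1Fun_eq {L M : Fin 2 → Vec F 2} (h : Generic (Sum.elim L M)) :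
    a1Fun L M = e2 (L 0) (M 0) + e2 (L 1) (M 1) - e2 (L 1) (M 0) - e2 (L 0) (M 1) := by
  have h1 := fun i j => (e2_ne h i j).isUnit
  unfold a1Fun crossRatio e2
  rw [div_eq_mul_inv, uclass_mul ((h1 0 0).mul (h1 1 1)) ((h1 1 0).mul (h1 0 1)).inv, uclass_inv,
    uclass_mul (h1 0 0) (h1 1 1), uclass_mul (h1 1 0) (h1 0 1)]
  abel

theorem perm_two (σ : Equiv.Perm (Fin 2)) : σ = 1 ∨ σ = Equiv.swap 0 1 := by
  revert σ; decide

theorem e3_swap (x y z : Vec F 3) : e3 x y z = e3 y x z := by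
  unfold e3
  rw [← uclass_vol_perm ![y, x, z] (Equiv.swap 0 1)]
  congr 2
  funext t
  fin_cases t <;> rfl

theorem e3_swap' (x y z : Vec F 3) : e3 x y z = e3 x z y := by
  unfold e3
  rw [← uclass_vol_perm ![x, z, y] (Equiv.swap 1 2)]
  congr 2
  funext t
  fin_cases t <;> rfl

theorem IsProj.e2_eq {x : Vec F 3} (hx : x ≠ 0) {p : Vec F 3 →ₗ[F] Vec F 2} (hp : IsProj x p) :
    ∃ c : UnitsHalf F, ∀ y z, vol ![p y, p z] ≠ 0 → e2 (p y) (p z) = c + e3 x y z := by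
  obtain ⟨c, hc0, hc⟩ := hp.exists_vol hx
  refine ⟨uclass c, fun y z h => ?_⟩
  have h1 := hc ![y, z]
  have h2 : (fun i => p ((![y, z] : Fin 2 → Vec F 3) i)) = ![p y, p z] := by
    funext i; fin_cases i <;> rfl
  have h3 : (Fin.cons x ![y, z] : Fin 3 → Vec F 3) = ![x, y, z] := rfl
  rw [h2, h3] at h1
  rw [h1] at h
  rw [e2, e3, h1, uclass_mul hc0.isUnit (right_ne_zero_of_mul h).isUnit]

theorem e2_smul (g : Vec F 2 ≃ₗ[F] Vec F 2) (a b : Fˣ) (x y : Vec F 2) (h : vol ![x, y] ≠ 0) :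
    e2 (a • g x) (b • g y) = uclass (a : F) + uclass (b : F) +
      uclass (LinearMap.det g.toLinearMap) + e2 x y := by
  have e : ![a • g x, b • g y] = fun t => (![a, b] : Fin 2 → Fˣ) t •
      g.toLinearMap ((![x, y] : Fin 2 → Vec F 2) t) := by
    funext t; fin_cases t <;> rfl
  have h1 : IsUnit (LinearMap.det g.toLinearMap) := LinearEquiv.isUnit_det' g
  rw [e2, e, uclass_vol_smul, vol_map, Fin.prod_univ_two]
  simp only [Matrix.cons_val_zero, Matrix.cons_val_one]
  rw [uclass_mul (a.isUnit.mul b.isUnit) (h1.mul h.isUnit), uclass_mul a.isUnit b.isUnit,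
    uclass_mul h1 h.isUnit, e2]
  abel

theorem isScissors_a1Fun : IsScissors (F := F) (n := 1) a1Fun where
  skew_left L M h σ := by
    rw [a1Fun_eq h, a1Fun_eq (h.comp_left σ.injective)]
    rcases perm_two σ with rfl | rfl
    · simp
    · simp
      abel
  skew_right L M h σ := by
    rw [a1Fun_eq h, a1Fun_eq (h.comp_right σ.injective)]
    rcases perm_two σ with rfl | rfl
    · simp
    · simp
      abel
  add_left L M h := by
    have h1 : ∀ i : Fin 3, _ := fun i =>
      a1Fun_eq (h.comp_left (f := i.succAbove) Fin.succAbove_right_injective)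
    simp only [h1]
    simp [Fin.sum_univ_three, Fin.succAbove]
    abel
  add_right L M h := by
    have h1 : ∀ i : Fin 3, _ := fun i =>
      a1Fun_eq (h.comp_right (g := i.succAbove) Fin.succAbove_right_injective)
    simp only [h1]
    simp [Fin.sum_univ_three, Fin.succAbove]
    abel
  dual_left L M h p hp := by
    choose c hc using fun i => (hp i).e2_eq (h.left.ne_zero i)
    have h1 : ∀ i : Fin 3, _ := fun i => a1Fun_eq (h.proj_left (hp i))
    have h2 : ∀ (i : Fin 3) (k j : Fin 2), e2 (p i (L (i.succAbove k))) (p i (M j)) =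
        c i + e3 (L i) (L (i.succAbove k)) (M j) := fun i k j =>
      hc i _ _ (e2_ne (h.proj_left (hp i)) k j)
    simp only [h1, h2]
    simp [Fin.sum_univ_three, Fin.succAbove]
    rw [e3_swap (L 1) (L 0), e3_swap (L 1) (L 0), e3_swap (L 2) (L 0), e3_swap (L 2) (L 0),
      e3_swap (L 2) (L 1), e3_swap (L 2) (L 1)]
    abel
  dual_right L M h p hp := by
    choose c hc using fun i => (hp i).e2_eq (h.right.ne_zero i)
    have h1 : ∀ i : Fin 3, _ := fun i => a1Fun_eq (h.proj_right (hp i))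
    have h2 : ∀ (i : Fin 3) (k j : Fin 2), e2 (p i (L j)) (p i (M (i.succAbove k))) =
        c i + e3 (L j) (M i) (M (i.succAbove k)) := fun i k j => by
      rw [hc i _ _ (e2_ne (h.proj_right (hp i)) j k), e3_swap]
    simp only [h1, h2]
    simp [Fin.sum_univ_three, Fin.succAbove]
    rw [e3_swap' _ (M 1) (M 0), e3_swap' _ (M 1) (M 0), e3_swap' _ (M 2) (M 0),
      e3_swap' _ (M 2) (M 0), e3_swap' _ (M 2) (M 1), e3_swap' _ (M 2) (M 1)]
    abel
  proj_inv L M h g a b := by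
    have h1 : ∀ i j : Fin 2, _ := fun i j => e2_smul g (a i) (b j) _ _ (e2_ne h i j)
    rw [a1Fun_eq h, a1Fun_eq (h.smul_equiv_elim g a b)]
    simp only [h1]
    abel

/-- The cross-ratio map `a₁ : A_1(F) → Fˣ`, modulo 2-torsion. -/
def a1 : AGroup F 1 →+ UnitsHalf F := AGroup.lift a1Fun isScissors_a1Fun.lift_eq_zero

theorem a1_brProj {x : Vec F 3} (hx : x ≠ 0) {L M : Fin 2 → Vec F 3}
    (h : Generic (Sum.elim (fun k => proj x (L k)) (fun k => proj x (M k)))) :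
    a1 (brProj x L M) = e3 x (L 0) (M 0) + e3 x (L 1) (M 1) - e3 x (L 1) (M 0) -
      e3 x (L 0) (M 1) := by
  obtain ⟨c, hc⟩ := (proj_spec hx).e2_eq hx
  have h1 : a1 (brProj x L M) = a1Fun (fun k => proj x (L k)) (fun k => proj x (M k)) :=
    AGroup.lift_br _ _ h
  have h2 : ∀ i j, _ := fun i j => hc _ _ (e2_ne h i j)
  rw [h1, a1Fun_eq h]
  simp only [h2]
  abel

end

/-! ### The iterated coproduct -/

section
open TensorPower

/-- `⊗ⁿ U → ⊗ⁿ⁺¹ U`, `t ↦ t ⊗ u`, as a bilinear map. -/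
def snoc (U : Type*) [AddCommGroup U] [Module ZHalf U] (n : ℕ) :
    (⨂[ZHalf]^n U) →ₗ[ZHalf] U →ₗ[ZHalf] ⨂[ZHalf]^(n + 1) U :=
  ((TensorProduct.mk ZHalf (⨂[ZHalf]^n U) (⨂[ZHalf]^1 U)).compr₂
    (TensorPower.mulEquiv (R := ZHalf) (M := U) (n := n) (m := 1)).toLinearMap).compl₂
    (PiTensorProduct.subsingletonEquiv (R := ZHalf) (s := fun _ : Fin 1 => U) 0).symm.toLinearMap

theorem snoc_tprod {U : Type*} [AddCommGroup U] [Module ZHalf U] {n : ℕ} (a : Fin n → U) (u : U) :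
    snoc U n (PiTensorProduct.tprod ZHalf a) u =
      PiTensorProduct.tprod ZHalf (Fin.snoc a u : Fin (n + 1) → U) := by
  have h : (PiTensorProduct.subsingletonEquiv (R := ZHalf) (s := fun _ : Fin 1 => U) 0).symm u =
      PiTensorProduct.tprod ZHalf (fun _ : Fin 1 => u) := by
    rw [LinearEquiv.symm_apply_eq, PiTensorProduct.subsingletonEquiv_apply_tprod]
  have h2 := TensorPower.tprod_mul_tprod (R := ZHalf) a (fun _ : Fin 1 => u)
  rw [TensorPower.gMul_def] at h2
  simp only [snoc, LinearMap.compl₂_apply, LinearMap.compr₂_apply, LinearEquiv.coe_coe, h,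
    TensorProduct.mk_apply]
  rw [h2, Fin.append_right_eq_snoc]

/-- For `f : B → ⊗ⁿ U`, the map `f ⊗ Id : B ⊗ U → (⊗ⁿ U) ⊗ U = ⊗ⁿ⁺¹ U`. -/
def tensorId {B U : Type*} [AddCommGroup B] [AddCommGroup U] [Module ZHalf U] {n : ℕ}
    (f : B →+ ⨂[ZHalf]^n U) : B ⊗[ℤ] U →+ ⨂[ZHalf]^(n + 1) U :=
  TensorProduct.liftAddHom
    ((LinearMap.toAddMonoidHom'.comp (snoc U n).toAddMonoidHom).comp f) (by
      intro r b u
      change (snoc U n).flip u (f (r • b)) = snoc U n (f b) (r • u)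
      rw [map_zsmul f, map_zsmul ((snoc U n).flip u), map_zsmul (snoc U n (f b))]
      rfl)

theorem tensorId_tmul {B U : Type*} [AddCommGroup B] [AddCommGroup U] [Module ZHalf U] {n : ℕ}
    (f : B →+ ⨂[ZHalf]^n U) (b : B) (u : U) : tensorId f (b ⊗ₜ[ℤ] u) = snoc U n (f b) u := rfl

end

section
open TensorPower
variable {F : Type*} [Field F]

/-- The class of `u` in the first tensor power. -/
def single (U : Type*) [AddCommGroup U] [Module ZHalf U] : U →ₗ[ZHalf] ⨂[ZHalf]^1 U :=
  (PiTensorProduct.subsingletonEquiv (R := ZHalf) (s := fun _ : Fin 1 => U) 0).symm.toLinearMap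

theorem single_apply {U : Type*} [AddCommGroup U] [Module ZHalf U] (u : U) :
    single U u = PiTensorProduct.tprod ZHalf (fun _ : Fin 1 => u) := by
  change (PiTensorProduct.subsingletonEquiv (R := ZHalf) (s := fun _ : Fin 1 => U) 0).symm u = _
  rw [LinearEquiv.symm_apply_eq, PiTensorProduct.subsingletonEquiv_apply_tprod]

/-- The value on `⟨L; M⟩` of `ν_{1,1} : A_2(F) → A_1(F) ⊗ Fˣ = Fˣ ⊗ Fˣ`, the group `A_1(F)` being
identified with `Fˣ` by the cross-ratio. -/
def nu11Fun (L M : Fin 3 → Vec F 3) : ⨂[ZHalf]^2 (UnitsHalf F) :=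
  -(half ^ 3 • ∑ σ : Equiv.Perm (Fin 3), ∑ τ : Equiv.Perm (Fin 3),
    (((Equiv.Perm.sign σ : ℤ) * (Equiv.Perm.sign τ : ℤ) : ℤ) : ZHalf) •
      (PiTensorProduct.tprod ZHalf ![uclass (vol ![M (τ 0), L (σ 1), L (σ 2)]),
          a1 (brProj (M (τ 0)) ![L (σ 1), L (σ 2)] ![M (τ 1), M (τ 2)])] +
        PiTensorProduct.tprod ZHalf ![a1 (brProj (L (σ 0)) ![L (σ 1), L (σ 2)] ![M (τ 1), M (τ 2)]),
          uclass (vol ![L (σ 0), M (τ 1), M (τ 2)])]))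

/-- The product `u ⊗ v` as a bilinear map. -/
def pair (U : Type*) [AddCommGroup U] [Module ZHalf U] : U →ₗ[ZHalf] U →ₗ[ZHalf] ⨂[ZHalf]^2 U :=
  (snoc U 1).comp (single U)

theorem pair_apply {U : Type*} [AddCommGroup U] [Module ZHalf U] (u v : U) :
    pair U u v = PiTensorProduct.tprod ZHalf ![u, v] := by
  unfold pair
  rw [LinearMap.comp_apply, single_apply, snoc_tprod]
  congr 1
  funext i
  fin_cases i <;> rfl

theorem sum_perm_three {B : Type*} [AddCommGroup B] (f : Fin 3 → Fin 3 → Fin 3 → B) :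
    ∑ σ : Equiv.Perm (Fin 3), (Equiv.Perm.sign σ : ℤ) • f (σ 0) (σ 1) (σ 2) =
      f 0 1 2 - f 0 2 1 - f 1 0 2 + f 1 2 0 + f 2 0 1 - f 2 1 0 := by
  have h : (Finset.univ : Finset (Equiv.Perm (Fin 3))) =
      {1, Equiv.swap 1 2, Equiv.swap 0 1, Equiv.swap 0 1 * Equiv.swap 1 2,
        Equiv.swap 1 2 * Equiv.swap 0 1, Equiv.swap 0 2} := by decide
  rw [h, Finset.sum_insert (by decide), Finset.sum_insert (by decide),
    Finset.sum_insert (by decide), Finset.sum_insert (by decide), Finset.sum_insert (by decide),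
    Finset.sum_singleton]
  have h2 : Equiv.swap (0 : Fin 3) 2 1 = 1 := by decide
  have h3 : Equiv.swap (1 : Fin 3) 2 0 = 0 := by decide
  have h4 : Equiv.swap (0 : Fin 3) 1 2 = 2 := by decide
  simp [Equiv.Perm.mul_apply, h2, h3, h4]
  abel

theorem brProj_vec {x : Vec F 3} (a b c d : Vec F 3) (hx : x ≠ 0)
    (h : Generic (Sum.elim (fun k => proj x ((![a, b] : Fin 2 → Vec F 3) k))
      (fun k => proj x ((![c, d] : Fin 2 → Vec F 3) k)))) :
    a1 (brProj x ![a, b] ![c, d]) = e3 x a c + e3 x b d - e3 x b c - e3 x a d :=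
  a1_brProj hx h

theorem gen_left {L M : Fin 3 → Vec F 3} (h : Generic (Sum.elim L M))
    (σ τ : Equiv.Perm (Fin 3)) :
    a1 (brProj (L (σ 0)) ![L (σ 1), L (σ 2)] ![M (τ 1), M (τ 2)]) =
      e3 (L (σ 0)) (L (σ 1)) (M (τ 1)) + e3 (L (σ 0)) (L (σ 2)) (M (τ 2)) -
      e3 (L (σ 0)) (L (σ 2)) (M (τ 1)) - e3 (L (σ 0)) (L (σ 1)) (M (τ 2)) := by
  refine brProj_vec _ _ _ _ (h.left.ne_zero _) ?_
  have h1 := (generic_left (h.comp_left σ.injective) 0).comp_right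
    (g := fun k : Fin 2 => τ k.succ) (τ.injective.comp (Fin.succ_injective _))
  convert h1 using 2
  · funext k; fin_cases k <;> rfl
  · funext k; fin_cases k <;> rfl

theorem gen_right {L M : Fin 3 → Vec F 3} (h : Generic (Sum.elim L M))
    (σ τ : Equiv.Perm (Fin 3)) :
    a1 (brProj (M (τ 0)) ![L (σ 1), L (σ 2)] ![M (τ 1), M (τ 2)]) =
      e3 (M (τ 0)) (L (σ 1)) (M (τ 1)) + e3 (M (τ 0)) (L (σ 2)) (M (τ 2)) -
      e3 (M (τ 0)) (L (σ 2)) (M (τ 1)) - e3 (M (τ 0)) (L (σ 1)) (M (τ 2)) := by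
  refine brProj_vec _ _ _ _ (h.right.ne_zero _) ?_
  have h1 := (((h.swap.comp_left τ.injective).proj_left (i := 0)
    (proj_spec (h.right.ne_zero _))).comp_right
    (g := fun k : Fin 2 => σ k.succ) (σ.injective.comp (Fin.succ_injective _))).swap
  convert h1 using 2
  · funext k; fin_cases k <;> rfl
  · funext k; fin_cases k <;> rfl

theorem gen_nu {L M : Fin 3 → Vec F 3} (h : Generic (Sum.elim L M)) (i j : Fin 3) :
    a1 (brProj (L i) (fun k => L (i.succAbove k)) (fun k => M (j.succAbove k))) =
      e3 (L i) (L (i.succAbove 0)) (M (j.succAbove 0)) +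
      e3 (L i) (L (i.succAbove 1)) (M (j.succAbove 1)) -
      e3 (L i) (L (i.succAbove 1)) (M (j.succAbove 0)) -
      e3 (L i) (L (i.succAbove 0)) (M (j.succAbove 1)) :=
  a1_brProj (h.left.ne_zero _)
    ((generic_left h i).comp_right (g := j.succAbove) Fin.succAbove_right_injective)

/-- An auxiliary sum. -/
def altSum {W : Type*} [AddCommGroup W] [Module ZHalf W]
    (T : UnitsHalf F →ₗ[ZHalf] UnitsHalf F →ₗ[ZHalf] W) (L M : Fin 3 → Vec F 3) : W :=
  ∑ i : Fin 3, ∑ j : Fin 3, (-1 : ℤ) ^ ((i : ℕ) + (j : ℕ)) • T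
        (e3 (L i) (L (i.succAbove 0)) (M (j.succAbove 0)) +
          e3 (L i) (L (i.succAbove 1)) (M (j.succAbove 1)) -
          e3 (L i) (L (i.succAbove 1)) (M (j.succAbove 0)) -
          e3 (L i) (L (i.succAbove 0)) (M (j.succAbove 1)))
        (e3 (L i) (M (j.succAbove 0)) (M (j.succAbove 1)))

theorem nuFun_pair {L M : Fin 3 → Vec F 3} (h : Generic (Sum.elim L M)) :
    tensorId ((single (UnitsHalf F)).toAddMonoidHom.comp a1) (nuFun L M) =
      -altSum (pair (UnitsHalf F)) L M := by
  unfold nuFun altSum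
  rw [map_neg, map_sum, neg_inj]
  refine Finset.sum_congr rfl fun i _ => ?_
  rw [map_sum]
  refine Finset.sum_congr rfl fun j _ => ?_
  rw [map_zsmul, tensorId_tmul, AddMonoidHom.comp_apply, gen_nu h i j]
  have : (Fin.cons (L i) (fun k => M (j.succAbove k)) : Fin 3 → Vec F 3) =
      ![L i, M (j.succAbove 0), M (j.succAbove 1)] := by
    funext t; fin_cases t <;> rfl
  rw [this]
  rfl

/-- Half of the alternating sum: an identity for the first kind of summands. -/
theorem alt_left {W : Type*} [AddCommGroup W] [Module ZHalf W]
    (T : UnitsHalf F →ₗ[ZHalf] UnitsHalf F →ₗ[ZHalf] W) (L M : Fin 3 → Vec F 3) :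
    (∑ σ : Equiv.Perm (Fin 3), ∑ τ : Equiv.Perm (Fin 3),
      ((Equiv.Perm.sign σ : ℤ) * (Equiv.Perm.sign τ : ℤ)) • T
        (e3 (L (σ 0)) (L (σ 1)) (M (τ 1)) + e3 (L (σ 0)) (L (σ 2)) (M (τ 2)) -
          e3 (L (σ 0)) (L (σ 2)) (M (τ 1)) - e3 (L (σ 0)) (L (σ 1)) (M (τ 2)))
        (e3 (L (σ 0)) (M (τ 1)) (M (τ 2)))) =
    (4 : ℤ) • altSum T L M := by
  simp only [mul_smul, ← Finset.smul_sum]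
  rw [sum_perm_three (fun a b c => ∑ τ : Equiv.Perm (Fin 3), (Equiv.Perm.sign τ : ℤ) •
    T
        (e3 (L a) (L b) (M (τ 1)) + e3 (L a) (L c) (M (τ 2)) -
          e3 (L a) (L c) (M (τ 1)) - e3 (L a) (L b) (M (τ 2)))
        (e3 (L a) (M (τ 1)) (M (τ 2))))]
  simp only [fun a b c => sum_perm_three (fun _ d e => T
        (e3 (L a) (L b) (M d) + e3 (L a) (L c) (M e) -
          e3 (L a) (L c) (M d) - e3 (L a) (L b) (M e))
        (e3 (L a) (M d) (M e)))]
  simp only [altSum, Fin.sum_univ_three]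
  simp only [e3_swap' _ (M 1) (M 0), e3_swap' _ (M 2) (M 0), e3_swap' _ (M 2) (M 1),
    map_add, map_sub, LinearMap.add_apply, LinearMap.sub_apply]
  simp [Fin.succAbove]
  abel

/-- Half of the alternating sum: an identity for the second kind of summands. -/
theorem alt_right {W : Type*} [AddCommGroup W] [Module ZHalf W]
    (T : UnitsHalf F →ₗ[ZHalf] UnitsHalf F →ₗ[ZHalf] W) (L M : Fin 3 → Vec F 3) :
    (∑ σ : Equiv.Perm (Fin 3), ∑ τ : Equiv.Perm (Fin 3),
      ((Equiv.Perm.sign σ : ℤ) * (Equiv.Perm.sign τ : ℤ)) • T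
        (e3 (M (τ 0)) (L (σ 1)) (L (σ 2)))
        (e3 (M (τ 0)) (L (σ 1)) (M (τ 1)) + e3 (M (τ 0)) (L (σ 2)) (M (τ 2)) -
          e3 (M (τ 0)) (L (σ 2)) (M (τ 1)) - e3 (M (τ 0)) (L (σ 1)) (M (τ 2)))) =
    (4 : ℤ) • altSum T L M := by
  have hs : ∀ x y z : Vec F 3, e3 x y z = e3 y z x := fun x y z => by rw [e3_swap, e3_swap']
  have hML : ∀ i j k : Fin 3, e3 (M i) (L j) (L k) = e3 (L j) (L k) (M i) := fun i j k => hs _ _ _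
  have hML' : ∀ i j k : Fin 3, e3 (M i) (L j) (M k) = e3 (L j) (M i) (M k) := fun i j k =>
    e3_swap _ _ _
  simp only [hML, hML', mul_smul, ← Finset.smul_sum]
  rw [sum_perm_three (fun _ b c => ∑ τ : Equiv.Perm (Fin 3), (Equiv.Perm.sign τ : ℤ) •
    T (e3 (L b) (L c) (M (τ 0)))
        (e3 (L b) (M (τ 0)) (M (τ 1)) + e3 (L c) (M (τ 0)) (M (τ 2)) -
          e3 (L c) (M (τ 0)) (M (τ 1)) - e3 (L b) (M (τ 0)) (M (τ 2))))]
  simp only [fun b c => sum_perm_three (fun f d e => T (e3 (L b) (L c) (M f))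
        (e3 (L b) (M f) (M d) + e3 (L c) (M f) (M e) -
          e3 (L c) (M f) (M d) - e3 (L b) (M f) (M e)))]
  simp only [altSum, Fin.sum_univ_three]
  simp only [map_add, map_sub, LinearMap.add_apply, LinearMap.sub_apply]
  simp [Fin.succAbove]
  simp only [e3_swap' _ (M 1) (M 0), e3_swap' _ (M 2) (M 0), e3_swap' _ (M 2) (M 1),
    e3_swap (L 1) (L 0), e3_swap (L 2) (L 0), e3_swap (L 2) (L 1)]
  abel

theorem alt_both {W : Type*} [AddCommGroup W] [Module ZHalf W]
    (T : UnitsHalf F →ₗ[ZHalf] UnitsHalf F →ₗ[ZHalf] W) {L M : Fin 3 → Vec F 3}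
    (h : Generic (Sum.elim L M)) :
    half ^ 3 • (∑ σ : Equiv.Perm (Fin 3), ∑ τ : Equiv.Perm (Fin 3),
      (((Equiv.Perm.sign σ : ℤ) * (Equiv.Perm.sign τ : ℤ) : ℤ) : ZHalf) •
        (T (uclass (vol ![M (τ 0), L (σ 1), L (σ 2)]))
          (a1 (brProj (M (τ 0)) ![L (σ 1), L (σ 2)] ![M (τ 1), M (τ 2)])) +
        T (a1 (brProj (L (σ 0)) ![L (σ 1), L (σ 2)] ![M (τ 1), M (τ 2)]))
          (uclass (vol ![L (σ 0), M (τ 1), M (τ 2)])))) = altSum T L M := by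
  simp only [gen_left h, gen_right h, Int.cast_smul_eq_zsmul, smul_add, Finset.sum_add_distrib]
  have hl := alt_left T L M
  have hr := alt_right T L M
  simp only [e3] at hl hr ⊢
  rw [hl, hr]
  have h4 : (4 : ℤ) • altSum T L M = (4 : ZHalf) • altSum T L M := by
    rw [← Int.cast_smul_eq_zsmul ZHalf]; norm_num
  rw [h4, smul_smul, ← add_smul]
  have h2 : half ^ 3 * 4 + half ^ 3 * 4 = (half + half) ^ 3 := by ring
  rw [h2, half_add_half, one_pow, one_smul]

theorem nu11Fun_eq (L M : Fin 3 → Vec F 3) (h : Generic (Sum.elim L M)) :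
    nu11Fun L M = tensorId ((single (UnitsHalf F)).toAddMonoidHom.comp a1) (nuFun L M) := by
  rw [nuFun_pair h, ← alt_both (pair (UnitsHalf F)) h]
  simp only [pair_apply]
  rfl

theorem isScissors_nu11Fun :
    ∀ x, Rel x → FreeAbelianGroup.lift (fun P : GenPair F 2 => nu11Fun P.L P.M) x = 0 :=
  (isScissors_nuFun.map
    (tensorId ((single (UnitsHalf F)).toAddMonoidHom.comp a1))).lift_congr nu11Fun_eq

/-- The map `ν_{1,1} : A_2(F) → Fˣ ⊗ Fˣ`, modulo 2-torsion. -/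
def nu11 : AGroup F 2 →+ ⨂[ZHalf]^2 (UnitsHalf F) := AGroup.lift nu11Fun isScissors_nu11Fun

end

section
open TensorPower
variable {F : Type*} [Field F]

theorem perm_fin_one (σ : Equiv.Perm (Fin (0 + 1))) : σ = 1 := by
  ext i; have := (σ i).isLt; have := i.isLt; simp only [Equiv.Perm.one_apply]; omega

theorem isScissors_one : IsScissors (F := F) (n := 0) (fun _ _ => (1 : ℤ)) where
  skew_left L M h σ := by rw [perm_fin_one σ]; simp
  skew_right L M h σ := by rw [perm_fin_one σ]; simp
  add_left L M h := by simp [Fin.sum_univ_two]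
  add_right L M h := by simp [Fin.sum_univ_two]
  dual_left L M h p hp := by simp [Fin.sum_univ_two]
  dual_right L M h p hp := by simp [Fin.sum_univ_two]
  proj_inv L M h g a b := rfl

/-- The identification of `A_0(F)` with `ℤ`, for which `⟨l; m⟩ = 1`. -/
def degree : AGroup F 0 →+ ℤ := AGroup.lift (fun _ _ => 1) isScissors_one.lift_eq_zero

variable (F) in
/-- The iterated coproduct `ν_{[n]} : A_n(F) → ⊗ⁿ A_1(F) = ⊗ⁿ Fˣ`, modulo 2-torsion: it is the
composition of `ν_{n-1,1}`, `ν_{n-2,1} ⊗ Id`, …, `ν_{1,1} ⊗ Id`. -/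
def nuIter : (n : ℕ) → AGroup F n →+ ⨂[ZHalf]^n (UnitsHalf F)
  | 0 => ((zmultiplesHom _ (PiTensorProduct.tprod ZHalf Fin.elim0)).comp degree)
  | 1 => (single (UnitsHalf F)).toAddMonoidHom.comp a1
  | 2 => nu11
  | n + 3 => (tensorId (nuIter (n + 2))).comp nu

/-- The element `Λ_{n,1}(l_1,…,l_{2(n+1)})` of `A_n(F) ⊗ Fˣ`, for vectors `l_i` of an
`(n+1)`-dimensional space with volume form `ω • det` (these are all the volume forms, `ω ≠ 0`). -/
def motivicElement (n : ℕ) (ω : F) (l : Fin ((n + 1) + (n + 1)) → Vec F (n + 1)) :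
    AGroup F n ⊗[ℤ] UnitsHalf F :=
  ∑ σ : Equiv.Perm (Fin ((n + 1) + (n + 1))), (Equiv.Perm.sign σ : ℤ) •
    (br (fun i => l (σ (Fin.castAdd (n + 1) i))) (fun i => l (σ (Fin.natAdd (n + 1) i))) ⊗ₜ[ℤ]
      uclass (ω * vol (fun i => l (σ (Fin.natAdd (n + 1) i)))))

/-- The alternating sum of `Δ(l_1,…,l_n) ⊗ Δ(l_2,…,l_{n+1}) ⊗ … ⊗ Δ(l_n,…,l_{2n-1})`, for `2n`
vectors of the free module of rank `n` with volume form `ω • det`. -/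
def tateElement {A : Type*} [CommRing A] (n : ℕ) (ω : A) (l : Fin (n + n) → Vec A n) :
    ⨂[ZHalf]^n (UnitsHalf A) :=
  ∑ σ : Equiv.Perm (Fin (n + n)), ((Equiv.Perm.sign σ : ℤ) : ZHalf) •
    PiTensorProduct.tprod ZHalf fun k : Fin n =>
      uclass (ω * vol (fun a : Fin n => l (σ ⟨k + a, by omega⟩)))

end

/-! ### The moduli space `G_n` -/

section

/-- `2n` vectors in an `n`-dimensional space: the standard basis, followed by the columns of the
generic `n × n` matrix. -/
def chartVec (n : ℕ) : Fin (n + n) → Vec (MvPolynomial (Fin n × Fin n) ℚ) n :=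
  Fin.append (fun i => Pi.single i 1) (fun j i => MvPolynomial.X (i, j))

/-- The multiplicative set generated by the `n × n` minors of the matrix of the vectors above. -/
def minors (n : ℕ) : Submonoid (MvPolynomial (Fin n × Fin n) ℚ) :=
  Submonoid.closure (Set.range fun e : Fin n ↪ Fin (n + n) => vol (fun a => chartVec n (e a)))

/-- The coordinate ring `𝒪(G_n)` of the moduli space over `ℚ` of generic configurations of `2n`
vectors in an `n`-dimensional space. Up to `GL_n`, such a configuration has a unique representative
whose first `n` vectors form the standard basis, and it is generic if and only if all the `n × n`
minors are invertible. -/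
abbrev OG (n : ℕ) : Type := Localization (minors n)

theorem minor_ne_zero (n : ℕ) (e : Fin n ↪ Fin (n + n)) : vol (fun a => chartVec n (e a)) ≠ 0 := by
  let R : Matrix (Fin (n + n)) (Fin n) ℚ := fun i j => (i : ℚ) ^ (j : ℕ)
  let W : Matrix (Fin n) (Fin n) ℚ := Matrix.vandermonde (fun i : Fin n => (i : ℚ))
  have hinj : Function.Injective (fun i : Fin n => (i : ℚ)) := fun a b h => by
    simpa [Fin.ext_iff] using h
  have hW : IsUnit W.det := (Matrix.det_vandermonde_ne_zero_iff.2 hinj).isUnit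
  let φ : MvPolynomial (Fin n × Fin n) ℚ →+* ℚ :=
    MvPolynomial.eval fun x => (R * W⁻¹) (Fin.natAdd n x.2) x.1
  have hφ : ∀ i k, φ (chartVec n i k) = (R * W⁻¹) i k := by
    intro i k
    refine Fin.addCases (fun i => ?_) (fun i => ?_) i
    · have h1 : (R * W⁻¹) (Fin.castAdd n i) k = (W * W⁻¹) i k := by
        rw [Matrix.mul_apply, Matrix.mul_apply]; rfl
      rw [h1, Matrix.mul_nonsing_inv W hW]
      simp only [chartVec, Fin.append_left, Pi.single_apply, Matrix.one_apply, eq_comm (a := k)]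
      split_ifs <;> simp
    · simp only [chartVec, Fin.append_right, φ]
      exact MvPolynomial.eval_X _
  intro h0
  have h1 : φ (vol (fun a => chartVec n (e a))) =
      (Matrix.vandermonde (fun a => ((e a : Fin (n + n)) : ℚ)) * W⁻¹).det := by
    unfold vol
    rw [RingHom.map_det]
    congr 1
    ext a k
    change φ (chartVec n (e a) k) = _
    rw [hφ, Matrix.mul_apply, Matrix.mul_apply]; rfl
  rw [h0, map_zero, Matrix.det_mul] at h1
  have h2 : (Matrix.vandermonde (fun a => ((e a : Fin (n + n)) : ℚ))).det ≠ 0 := by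
    refine Matrix.det_vandermonde_ne_zero_iff.2 fun a b h => ?_
    exact e.injective (Fin.ext (by exact_mod_cast h))
  exact mul_ne_zero h2 ((Matrix.isUnit_nonsing_inv_det W hW).ne_zero) h1.symm

theorem minors_le (n : ℕ) : minors n ≤ nonZeroDivisors (MvPolynomial (Fin n × Fin n) ℚ) := by
  refine (Submonoid.closure_le).2 ?_
  rintro _ ⟨e, rfl⟩
  exact mem_nonZeroDivisors_of_ne_zero (minor_ne_zero n e)

instance (n : ℕ) : IsDomain (OG n) := IsLocalization.isDomain_localization (minors_le n)

/-- The field `ℚ(G_n)` of rational functions on `G_n`. -/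
abbrev QG (n : ℕ) : Type := FractionRing (OG n)

/-- The universal generic configuration of `2n` vectors over `G_n`. -/
def univVec (n : ℕ) : Fin (n + n) → Vec (OG n) n :=
  fun i k => algebraMap _ (OG n) (chartVec n i k)

/-- The universal configuration over the generic point of `G_n`. -/
def ratVec (n : ℕ) : Fin (n + n) → Vec (QG n) n :=
  fun i k => algebraMap (OG n) (QG n) (univVec n i k)

theorem isUnit_vol_univVec (n : ℕ) (e : Fin n ↪ Fin (n + n)) :
    IsUnit (vol (fun a => univVec n (e a))) := by
  have h : vol (fun a => univVec n (e a)) =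
      algebraMap _ (OG n) (vol (fun a => chartVec n (e a))) := by
    unfold vol
    rw [RingHom.map_det]
    rfl
  rw [h]
  exact IsLocalization.map_units (OG n)
    (⟨_, Submonoid.subset_closure ⟨e, rfl⟩⟩ : minors n)

theorem generic_ratVec (n : ℕ) : Generic (ratVec n) := by
  intro s hs
  obtain ⟨t, hst, ht⟩ := Finset.exists_superset_card_eq hs (by simp)
  let e : Fin n ↪ Fin (n + n) := (t.orderEmbOfFin ht).toEmbedding
  have h : vol (fun a => ratVec n (e a)) =
      algebraMap (OG n) (QG n) (vol (fun a => univVec n (e a))) := by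
    unfold vol
    rw [RingHom.map_det]
    rfl
  have h1 : IsUnit (Matrix.of (fun a => ratVec n (e a))) := by
    rw [Matrix.isUnit_iff_isUnit_det]
    change IsUnit (vol (fun a => ratVec n (e a)))
    rw [h]
    exact (isUnit_vol_univVec n e).map _
  have h2 : LinearIndependent (QG n) (fun a => ratVec n (e a)) :=
    Matrix.linearIndependent_rows_iff_isUnit.2 h1
  have h3 : ∀ i : s, ∃ a : Fin n, e a = i := fun i => by
    have : (i : Fin (n + n)) ∈ Set.range (t.orderEmbOfFin ht) := by
      rw [Finset.range_orderEmbOfFin]; exact hst i.2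
    exact this
  choose f hf using h3
  have hfi : Function.Injective f := fun a b hab => by
    apply Subtype.ext; rw [← hf a, ← hf b, hab]
  have h4 := h2.comp f hfi
  simpa only [Function.comp_def, hf] using h4

end

end GrassmannianPolylog
end

/-!
The formula for `ν_{m-1,1}` with `m > 2` also gives `ν_{1,1}` and the cross-ratio
(`nuIter_succ_br`), so that `ν_{[n]}` can be iterated uniformly. Each step singles out an entry of
`L` and an entry of `M`, projects along the former, drops the latter, and appends a volume on the
right. Projecting changes the volume form by a constant; such constants do not matter, by the
additivity relations (`nuFun_eq_of`). Hence, after all the steps (`nuIter_br`),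

`ν_{[n]}⟨L; M⟩ = (-1)ⁿ ∑_{σ,τ} sgn σ sgn τ
  Δ(l_{σ0}, …, l_{σ(n-1)}, m_{τn}) ⊗ … ⊗ Δ(l_{σ0}, m_{τ1}, …, m_{τn})`.

Appending `Δ(m_0, …, m_n)` and alternating over all `2n + 2` vectors makes the `((n+1)!)²` pairs
`(σ, τ)` contribute equally (`alternation_snoc_flagSum`). In the summand that remains, each factor
arises from the preceding one by dropping one of the `l`'s and adding one of the `m`'s. Listed as
`l_{n-1}, …, l_0, m_n, …, m_0, l_n`, the vectors therefore make it the tensor product of the volumes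
of successive windows of length `n + 1`. This reordering is the reflection `x ↦ n - 1 - x` of
`ℤ/(2n+2)`; it is odd, which accounts for the last sign (`alternation_fullFlagTensor`).

The argument applies to any `2n + 2` vectors in general position over any field
(`tensorId_nuIter_motivicElement`), and in particular to the universal ones.
-/

noncomputable section

namespace GrassmannianPolylog
open scoped TensorPower

/-! ### Permutations of finite ordinals -/

section

/-- A permutation of `n + 1` letters is determined by the image `i` of `0` and by the permutation
that it induces on the remaining letters, once these are renumbered by `i.succAbove`. -/
theorem sum_perm_succ {B : Type*} [AddCommMonoid B] {n : ℕ} (f : Equiv.Perm (Fin (n + 1)) → B) :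
    ∑ σ, f σ = ∑ i : Fin (n + 1), ∑ σ : Equiv.Perm (Fin n),
      f ((Fin.cycleRange i)⁻¹ * Equiv.Perm.decomposeFin.symm (0, σ)) := by
  rw [← Fintype.sum_prod_type']
  let e : Fin (n + 1) × Equiv.Perm (Fin n) → Equiv.Perm (Fin (n + 1)) :=
    fun x => (Fin.cycleRange x.1)⁻¹ * Equiv.Perm.decomposeFin.symm (0, x.2)
  have he : Function.Injective e := by
    rintro ⟨i, σ⟩ ⟨j, τ⟩ h
    have h0 : ∀ (i : Fin (n + 1)) (σ : Equiv.Perm (Fin n)), e (i, σ) 0 = i := fun i σ => by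
      simp only [e, Equiv.Perm.mul_apply, Equiv.Perm.decomposeFin_symm_apply_zero]
      exact Fin.cycleRange_symm_zero i
    obtain rfl : i = j := by rw [← h0 i σ, h, h0]
    have := Equiv.Perm.decomposeFin.symm.injective (mul_left_cancel h)
    simpa using this
  have hb : Function.Bijective e :=
    (Fintype.bijective_iff_injective_and_card e).2 ⟨he, by simp [Fintype.card_perm, Nat.factorial]⟩
  exact (Fintype.sum_bijective e hb _ _ fun _ => rfl).symm

theorem cycleRange_inv_mul_zero {n : ℕ} (i : Fin (n + 1)) (σ : Equiv.Perm (Fin n)) :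
    ((Fin.cycleRange i)⁻¹ * Equiv.Perm.decomposeFin.symm (0, σ)) 0 = i := by
  rw [Equiv.Perm.mul_apply, Equiv.Perm.decomposeFin_symm_apply_zero]
  exact Fin.cycleRange_symm_zero i

theorem cycleRange_inv_mul_succ {n : ℕ} (i : Fin (n + 1)) (σ : Equiv.Perm (Fin n)) (k : Fin n) :
    ((Fin.cycleRange i)⁻¹ * Equiv.Perm.decomposeFin.symm (0, σ)) k.succ = i.succAbove (σ k) := by
  rw [Equiv.Perm.mul_apply, Equiv.Perm.decomposeFin_symm_apply_succ, Equiv.swap_self]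
  exact Fin.cycleRange_symm_succ i (σ k)

theorem sign_cycleRange_inv_mul {n : ℕ} (i : Fin (n + 1)) (σ : Equiv.Perm (Fin n)) :
    (Equiv.Perm.sign ((Fin.cycleRange i)⁻¹ * Equiv.Perm.decomposeFin.symm (0, σ)) : ℤ) =
      (-1) ^ (i : ℕ) * Equiv.Perm.sign σ := by
  simp [Fin.sign_cycleRange, Equiv.Perm.decomposeFin.symm_sign]

theorem sign_revPerm_add_self (m : ℕ) :
    Equiv.Perm.sign (Fin.revPerm : Equiv.Perm (Fin (m + m))) = (-1) ^ m := by
  have h : ∀ N : ℕ, Equiv.Perm.sign (Fin.revPerm : Equiv.Perm (Fin N)) =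
      ∏ j ∈ Finset.range N, (-1 : ℤˣ) ^ j := by
    intro N
    rw [Equiv.Perm.sign_eq_prod_prod_Iio, Finset.prod_range]
    refine Finset.prod_congr rfl fun j _ => ?_
    rw [Finset.prod_congr rfl (g := fun _ => (-1 : ℤˣ)), Finset.prod_const, Fin.card_Iio]
    intro i hi
    rw [if_neg]
    simpa using (Finset.mem_Iio.1 hi).le
  rw [h]
  induction m with
  | zero => simp
  | succ m ih =>
    have h2 : m + 1 + (m + 1) = m + m + 1 + 1 := by ring
    rw [h2, Finset.prod_range_succ, Finset.prod_range_succ, ih, mul_assoc, ← pow_add,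
      pow_succ (-1 : ℤˣ) m]
    congr 1
    exact Odd.neg_one_pow ⟨m + m, by ring⟩

theorem finRotate_pow_val {N : ℕ} (k : ℕ) (i : Fin N) :
    (((finRotate N) ^ k) i : ℕ) = (i + k) % N := by
  obtain _ | N := N
  · exact i.elim0
  induction k with
  | zero => simp [Nat.mod_eq_of_lt i.isLt]
  | succ k ih =>
    rw [pow_succ', Equiv.Perm.mul_apply, finRotate_apply, Fin.val_add, ih, Fin.val_one',
      ← Nat.add_mod, add_assoc]

/-- The reflection `x ↦ n - 1 - x` of `ℤ/(2n+2)`. -/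
def reflection (n : ℕ) : Equiv.Perm (Fin ((n + 1) + (n + 1))) :=
  Fin.revPerm * finRotate ((n + 1) + (n + 1)) ^ (n + 2)

theorem sign_reflection (n : ℕ) : Equiv.Perm.sign (reflection n) = -1 := by
  rw [reflection, map_mul, map_pow, sign_revPerm_add_self, sign_finRotate, ← pow_mul, ← pow_add]
  have h : n + 1 + (n + 1) - 1 = 2 * n + 1 := by omega
  rw [h]
  exact Odd.neg_one_pow (by
    rw [show n + 1 + (2 * n + 1) * (n + 2) = 2 * (n * n + 3 * n + 1) + 1 by ring]
    exact odd_two_mul_add_one _)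

theorem reflection_castAdd_val (n : ℕ) (a : Fin (n + 1)) (h : (a : ℕ) < n) :
    (reflection n (Fin.castAdd (n + 1) a) : ℕ) = n - 1 - a := by
  rw [reflection, Equiv.Perm.mul_apply, Fin.revPerm_apply, Fin.val_rev, finRotate_pow_val,
    Fin.val_castAdd, Nat.mod_eq_of_lt (by omega)]
  omega

theorem reflection_natAdd_val (n : ℕ) (a : Fin (n + 1)) :
    (reflection n (Fin.natAdd (n + 1) a) : ℕ) = 2 * n - a := by
  rw [reflection, Equiv.Perm.mul_apply, Fin.revPerm_apply, Fin.val_rev, finRotate_pow_val,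
    Fin.val_natAdd, Nat.mod_eq_sub_mod (by omega), Nat.mod_eq_of_lt (by omega)]
  omega

end

/-! ### Iterated coproducts as sums over flags -/

section
theorem symmetric_cons {X U : Type*} {n : ℕ} {w : (Fin (n + 2) → X) → U}
    (hw : ∀ (v : Fin (n + 2) → X) (σ : Equiv.Perm (Fin (n + 2))), w (fun a => v (σ a)) = w v)
    (x : X) (v : Fin (n + 1) → X) (σ : Equiv.Perm (Fin (n + 1))) :
    w (Fin.cons x (fun a => v (σ a))) = w (Fin.cons x v) := by
  rw [← hw (Fin.cons x v) (Equiv.Perm.decomposeFin.symm (0, σ))]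
  congr 1
  funext i
  refine Fin.cases ?_ (fun i => ?_) i <;> simp

variable {X U : Type*} [AddCommGroup U] [Module ZHalf U]

/-- The tensor `⊗_p w(l_0, …, l_{n-1-p}, m_{n-p}, …, m_n)`, `0 ≤ p < n`. The points are abstract
labels, and `w` stands for the class of the volume. -/
def flagTensor {n : ℕ} (w : (Fin (n + 1) → X) → U) (L M : Fin (n + 1) → X) : ⨂[ZHalf]^n U :=
  PiTensorProduct.tprod ZHalf fun p : Fin n =>
    w fun a => if (a : ℕ) + p < n then L a else M a

/-- The tensor of `flagTensor` with the last factor `w(m_0, …, m_n)` appended. -/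
def fullFlagTensor {n : ℕ} (w : (Fin (n + 1) → X) → U) (L M : Fin (n + 1) → X) :
    ⨂[ZHalf]^(n + 1) U :=
  PiTensorProduct.tprod ZHalf fun p : Fin (n + 1) =>
    w fun a => if (a : ℕ) + p < n then L a else M a

/-- The alternation of `flagTensor` over the permutations of `L` and of `M`. -/
def flagSum {n : ℕ} (w : (Fin (n + 1) → X) → U) (L M : Fin (n + 1) → X) : ⨂[ZHalf]^n U :=
  ∑ σ : Equiv.Perm (Fin (n + 1)), ∑ τ : Equiv.Perm (Fin (n + 1)),
    (((Equiv.Perm.sign σ : ℤ) * (Equiv.Perm.sign τ : ℤ) : ℤ) : ZHalf) •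
      flagTensor w (fun a => L (σ a)) (fun a => M (τ a))

theorem snoc_flagTensor {n : ℕ} (w : (Fin (n + 1) → X) → U) (L M : Fin (n + 1) → X) :
    snoc U n (flagTensor w L M) (w M) = fullFlagTensor w L M := by
  rw [flagTensor, snoc_tprod, fullFlagTensor]
  congr 1
  funext p
  refine Fin.lastCases ?_ (fun p => ?_) p
  · have : ∀ a : Fin (n + 1), ¬ (a : ℕ) + n < n := fun a => by omega
    simp [this]
  · simp

/-- Every factor contains `l_0` and none contains `m_0`; the last one contains no other of the
`l`'s. -/
theorem flagTensor_succ {n : ℕ} (w : (Fin (n + 2) → X) → U) (L M : Fin (n + 2) → X) :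
    flagTensor w L M =
      snoc U n (flagTensor (fun v => w (Fin.cons (L 0) v)) (fun a => L a.succ) (fun a => M a.succ))
        (w (Fin.cons (L 0) (fun a => M a.succ))) := by
  rw [snoc_flagTensor (fun v => w (Fin.cons (L 0) v))]
  unfold flagTensor fullFlagTensor
  congr 1
  funext p
  congr 1
  funext a
  refine Fin.cases ?_ (fun a => ?_) a
  · have : (p : ℕ) ≤ n := by omega
    simp [this]
  · have : (a : ℕ) + 1 + p < n + 1 ↔ (a : ℕ) + p < n := by omega
    simp [this]

/-- Expansion of the alternation along the first entries of the two tuples, which is the recursion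
satisfied by the iterated coproduct. -/
theorem flagSum_succ {n : ℕ} {w : (Fin (n + 2) → X) → U}
    (hw : ∀ (v : Fin (n + 2) → X) (σ : Equiv.Perm (Fin (n + 2))), w (fun a => v (σ a)) = w v)
    (L M : Fin (n + 2) → X) :
    flagSum w L M = ∑ i : Fin (n + 2), ∑ j : Fin (n + 2), (-1 : ZHalf) ^ ((i : ℕ) + (j : ℕ)) •
      snoc U n (flagSum (fun v => w (Fin.cons (L i) v)) (fun k => L (i.succAbove k))
        (fun k => M (j.succAbove k))) (w (Fin.cons (L i) (fun k => M (j.succAbove k)))) := by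
  unfold flagSum
  rw [sum_perm_succ]
  refine Finset.sum_congr rfl fun i _ => ?_
  simp only [fun σ : Equiv.Perm (Fin (n + 1)) => sum_perm_succ (fun τ : Equiv.Perm (Fin (n + 2)) =>
    (((Equiv.Perm.sign ((Fin.cycleRange i)⁻¹ * Equiv.Perm.decomposeFin.symm (0, σ)) : ℤ) *
      (Equiv.Perm.sign τ : ℤ) : ℤ) : ZHalf) • flagTensor w (fun a => L (((Fin.cycleRange i)⁻¹ *
        Equiv.Perm.decomposeFin.symm (0, σ)) a)) (fun a => M (τ a)))]
  rw [Finset.sum_comm]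
  refine Finset.sum_congr rfl fun j _ => ?_
  simp only [map_sum, LinearMap.sum_apply, Finset.smul_sum]
  refine Finset.sum_congr rfl fun σ _ => Finset.sum_congr rfl fun τ _ => ?_
  rw [map_smul, LinearMap.smul_apply, smul_smul, flagTensor_succ, sign_cycleRange_inv_mul,
    sign_cycleRange_inv_mul]
  simp only [cycleRange_inv_mul_zero, cycleRange_inv_mul_succ]
  rw [symmetric_cons hw (L i) (fun k => M (j.succAbove k)) τ]
  congr 1
  push_cast
  ring

end

section
variable {F : Type*} [Field F]

theorem nuIter_zero_br {L M : Fin 1 → Vec F 1} (h : Generic (Sum.elim L M)) :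
    nuIter F 0 (br L M) = PiTensorProduct.tprod ZHalf Fin.elim0 := by
  have h1 : degree (br L M) = 1 :=
    AGroup.lift_br (fun _ _ => (1 : ℤ)) isScissors_one.lift_eq_zero h
  change (zmultiplesHom _ (PiTensorProduct.tprod ZHalf Fin.elim0)) (degree (br L M)) = _
  rw [h1, zmultiplesHom_apply, one_smul]

/-- The formula for `ν_{m-1,1}` is uniform in `m`: for `m = 2` it agrees with the alternating sum
that defines `ν_{1,1}`, and for `m = 1` it gives the cross-ratio. -/
theorem nuIter_succ_br {n : ℕ} {L M : Fin (n + 2) → Vec F (n + 2)} (h : Generic (Sum.elim L M)) :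
    nuIter F (n + 1) (br L M) = tensorId (nuIter F n) (nuFun L M) := by
  match n with
  | 0 =>
    have h1 : nuIter F (0 + 1) (br L M) = single (UnitsHalf F) (a1Fun L M) :=
      congrArg (single (UnitsHalf F)) (AGroup.lift_br a1Fun isScissors_a1Fun.lift_eq_zero h)
    have h2 : ∀ i j : Fin 2, tensorId (nuIter F 0)
        (brProj (L i) (fun k => L (i.succAbove k)) (fun k => M (j.succAbove k)) ⊗ₜ[ℤ]
          uclass (vol (Fin.cons (L i) (fun k => M (j.succAbove k)) : Fin 2 → Vec F 2))) =
        single (UnitsHalf F) (e2 (L i) (M (j.succAbove 0))) := by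
      intro i j
      rw [tensorId_tmul, brProj, nuIter_zero_br ((generic_left h i).comp_right (g := j.succAbove)
        Fin.succAbove_right_injective), snoc_tprod, single_apply, e2]
      have e : (Fin.cons (L i) (fun k => M (j.succAbove k)) : Fin 2 → Vec F 2) =
          ![L i, M (j.succAbove 0)] := by
        funext t; fin_cases t <;> rfl
      rw [e]
      congr 1
    rw [h1, a1Fun_eq h, nuFun]
    simp only [map_neg, map_sum, map_zsmul, h2]
    simp [Fin.sum_univ_two, Fin.succAbove]
    abel
  | 1 =>
    exact (AGroup.lift_br nu11Fun isScissors_nu11Fun h).trans (nu11Fun_eq L M h)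
  | n + 2 =>
    exact congrArg (tensorId (nuIter F (n + 2))) (AGroup.lift_br nuFun isScissors_nuFun.lift_eq_zero h)

/-- `ν_{[n]}` on a symbol, as a sum over the orderings of `L` and of `M`. The vectors `f x` are
labelled by a set `X` and `w` computes their volumes up to the constant `c`, so that in the
induction the labels can be kept while `f` is composed with projections, each of which contributes
to `c` only. -/
theorem nuIter_br {X : Type*} (n : ℕ) (f : X → Vec F (n + 1)) (w : (Fin (n + 1) → X) → UnitsHalf F)
    (hw : ∀ (v : Fin (n + 1) → X) (σ : Equiv.Perm (Fin (n + 1))), w (fun a => v (σ a)) = w v)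
    (c : UnitsHalf F)
    (hc : ∀ v : Fin (n + 1) → X, vol (fun a => f (v a)) ≠ 0 →
      uclass (vol (fun a => f (v a))) = c + w v)
    (L M : Fin (n + 1) → X)
    (h : Generic (Sum.elim (fun a => f (L a)) (fun a => f (M a)))) :
    nuIter F n (br (fun a => f (L a)) (fun a => f (M a))) = (-1 : ZHalf) ^ n • flagSum w L M := by
  induction n generalizing c with
  | zero =>
    have : Subsingleton (Equiv.Perm (Fin (0 + 1))) :=
      inferInstanceAs (Subsingleton (Equiv.Perm (Fin 1)))
    rw [nuIter_zero_br h, flagSum, Fintype.sum_subsingleton _ 1, Fintype.sum_subsingleton _ 1]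
    simp only [map_one, pow_zero, one_smul, Units.val_one, mul_one, Int.cast_one, flagTensor]
    congr 1
    exact Subsingleton.elim _ _
  | succ n ih =>
    -- The summand `c` is the same for all `(i, j)`, and therefore drops out.
    rw [nuIter_succ_br h, nuFun_eq_of h (fun _ => c) (fun _ => 0)
      (fun i j => w (Fin.cons (L i) (fun k => M (j.succAbove k)))), flagSum_succ hw]
    · rw [map_neg, map_sum, pow_succ, mul_neg_one, neg_smul, Finset.smul_sum, neg_inj]
      refine Finset.sum_congr rfl fun i _ => ?_
      rw [map_sum, Finset.smul_sum]
      refine Finset.sum_congr rfl fun j _ => ?_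
      have hi := h.left.ne_zero i
      obtain ⟨c', hc'0, hc'⟩ := (proj_spec hi).exists_vol hi
      rw [map_zsmul, tensorId_tmul, brProj,
        ih (fun x => proj (f (L i)) (f x)) (fun v => w (Fin.cons (L i) v)) (symmetric_cons hw (L i))
          (uclass c' + c) ?_ (fun k => L (i.succAbove k)) (fun k => M (j.succAbove k))
          ((generic_left h i).comp_right (g := j.succAbove) Fin.succAbove_right_injective),
        map_smul, LinearMap.smul_apply, ← Int.cast_smul_eq_zsmul ZHalf, Int.cast_pow, Int.cast_neg,
        Int.cast_one, smul_comm]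
      intro v hv
      have e : (Fin.cons (f (L i)) (fun a => f (v a)) : Fin (n + 2) → Vec F (n + 2)) =
          fun a => f ((Fin.cons (L i) v : Fin (n + 2) → X) a) := by
        funext t
        refine Fin.cases ?_ (fun t => ?_) t <;> simp
      rw [hc', e] at hv ⊢
      have hv' := right_ne_zero_of_mul hv
      rw [uclass_mul hc'0.isUnit hv'.isUnit, hc _ hv', add_assoc]
    · intro i j
      have hv := generic_cons h i j
      have e : (Fin.cons (f (L i)) (fun k => f (M (j.succAbove k))) :
          Fin (n + 2) → Vec F (n + 2)) =
          fun a => f ((Fin.cons (L i) (fun k => M (j.succAbove k)) : Fin (n + 2) → X) a) := by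
        funext t
        refine Fin.cases ?_ (fun t => ?_) t <;> simp
      rw [e] at hv ⊢
      rw [hc _ hv, add_zero]

end


/-! ### Alternation over all the vectors -/

section
variable {X U : Type*} [AddCommGroup U] [Module ZHalf U]

theorem snoc_flagSum {n : ℕ} {w : (Fin (n + 1) → X) → U}
    (hw : ∀ (v : Fin (n + 1) → X) (σ : Equiv.Perm (Fin (n + 1))), w (fun a => v (σ a)) = w v)
    (L M : Fin (n + 1) → X) :
    snoc U n (flagSum w L M) (w M) =
      ∑ σ : Equiv.Perm (Fin (n + 1)), ∑ τ : Equiv.Perm (Fin (n + 1)),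
        (((Equiv.Perm.sign σ : ℤ) * (Equiv.Perm.sign τ : ℤ) : ℤ) : ZHalf) •
          fullFlagTensor w (fun a => L (σ a)) (fun a => M (τ a)) := by
  simp only [flagSum, map_sum, LinearMap.sum_apply]
  refine Finset.sum_congr rfl fun σ _ => Finset.sum_congr rfl fun τ _ => ?_
  rw [map_smul, LinearMap.smul_apply, ← hw M τ, snoc_flagTensor]

/-- The alternation over `S_{2n+2}` absorbs the alternations over the two halves. -/
theorem alternation_snoc_flagSum {n : ℕ} {w : (Fin (n + 1) → X) → U}
    (hw : ∀ (v : Fin (n + 1) → X) (σ : Equiv.Perm (Fin (n + 1))), w (fun a => v (σ a)) = w v)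
    (x : Fin ((n + 1) + (n + 1)) → X) :
    ∑ π : Equiv.Perm (Fin ((n + 1) + (n + 1))), ((Equiv.Perm.sign π : ℤ) : ZHalf) •
        snoc U n (flagSum w (fun a => x (π (Fin.castAdd (n + 1) a)))
          (fun a => x (π (Fin.natAdd (n + 1) a)))) (w (fun a => x (π (Fin.natAdd (n + 1) a)))) =
      ((n + 1).factorial : ZHalf) ^ 2 •
        ∑ π : Equiv.Perm (Fin ((n + 1) + (n + 1))), ((Equiv.Perm.sign π : ℤ) : ZHalf) •
          fullFlagTensor w (fun a => x (π (Fin.castAdd (n + 1) a)))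
            (fun a => x (π (Fin.natAdd (n + 1) a))) := by
  simp only [snoc_flagSum hw, Finset.smul_sum (s := (Finset.univ : Finset (Equiv.Perm (Fin (n + 1))))),
    smul_smul]
  rw [Finset.sum_comm]
  have h : ∀ σ τ : Equiv.Perm (Fin (n + 1)),
      ∑ π : Equiv.Perm (Fin ((n + 1) + (n + 1))), (((Equiv.Perm.sign π : ℤ) : ZHalf) *
        (((Equiv.Perm.sign σ : ℤ) * (Equiv.Perm.sign τ : ℤ) : ℤ) : ZHalf)) •
          fullFlagTensor w (fun a => x (π (Fin.castAdd (n + 1) (σ a))))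
            (fun a => x (π (Fin.natAdd (n + 1) (τ a)))) =
      ∑ π : Equiv.Perm (Fin ((n + 1) + (n + 1))), ((Equiv.Perm.sign π : ℤ) : ZHalf) •
          fullFlagTensor w (fun a => x (π (Fin.castAdd (n + 1) a)))
            (fun a => x (π (Fin.natAdd (n + 1) a))) := by
    intro σ τ
    symm
    rw [← Equiv.sum_comp (Equiv.mulRight (finSumFinEquiv.permCongr (Equiv.sumCongr σ τ)))]
    refine Finset.sum_congr rfl fun π _ => ?_
    have hs : Equiv.Perm.sign (finSumFinEquiv.permCongr (Equiv.sumCongr σ τ)) =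
        Equiv.Perm.sign σ * Equiv.Perm.sign τ := by
      rw [Equiv.Perm.sign_permCongr]
      exact Equiv.Perm.sign_sumCongr σ τ
    simp only [Equiv.coe_mulRight, map_mul, hs, Equiv.Perm.mul_apply, Equiv.permCongr_apply,
      finSumFinEquiv_symm_apply_castAdd, finSumFinEquiv_symm_apply_natAdd, Equiv.sumCongr_apply,
      Sum.map_inl, Sum.map_inr, finSumFinEquiv_apply_left, finSumFinEquiv_apply_right]
    push_cast
    rfl
  simp only [Finset.sum_comm (s := (Finset.univ : Finset (Equiv.Perm (Fin ((n + 1) + (n + 1)))))), h]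
  simp only [Finset.sum_const, Finset.card_univ, Fintype.card_perm, Fintype.card_fin]
  rw [← Nat.cast_smul_eq_nsmul ZHalf, ← Nat.cast_smul_eq_nsmul ZHalf, smul_smul, pow_two]

/-- After the vectors are listed in the order given by `reflection`, the arguments of the `k`-th
factor of `fullFlagTensor` become the consecutive vectors with the indices `k, …, k + n`, up to
their order. -/
theorem fullFlagTensor_reflection {n : ℕ} {w : (Fin (n + 1) → X) → U}
    (hw : ∀ (v : Fin (n + 1) → X) (σ : Equiv.Perm (Fin (n + 1))), w (fun a => v (σ a)) = w v)
    (x : Fin ((n + 1) + (n + 1)) → X) :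
    fullFlagTensor w (fun a => x (reflection n (Fin.castAdd (n + 1) a)))
        (fun a => x (reflection n (Fin.natAdd (n + 1) a))) =
      PiTensorProduct.tprod ZHalf fun k : Fin (n + 1) =>
        w fun a : Fin (n + 1) => x ⟨k + a, by omega⟩ := by
  unfold fullFlagTensor
  congr 1
  funext k
  -- The `a`-th argument of the `k`-th factor is the vector with the index `k + θ a`.
  let θ : Fin (n + 1) → Fin (n + 1) := fun a =>
    if h : (a : ℕ) + k < n then ⟨n - 1 - k - a, by omega⟩ else ⟨2 * n - k - a, by omega⟩
  have hv : ∀ a, (θ a : ℕ) = if (a : ℕ) + k < n then n - 1 - k - a else 2 * n - k - a := by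
    intro a
    simp only [θ]
    split_ifs <;> rfl
  have hθ : Function.Involutive θ := by
    intro a
    ext
    rw [hv, hv]
    by_cases h : (a : ℕ) + k < n
    · rw [if_pos h, if_pos (by omega)]
      omega
    · rw [if_neg h, if_neg (by omega)]
      omega
  refine Eq.trans (congrArg w (funext fun a => ?_)) (hw _ hθ.toPerm)
  rw [Function.Involutive.coe_toPerm]
  split_ifs with h
  · refine congrArg x (Fin.ext ?_)
    rw [reflection_castAdd_val n a (by omega)]
    simp only [hv, h, if_true]
    omega
  · refine congrArg x (Fin.ext ?_)
    rw [reflection_natAdd_val n a]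
    simp only [hv, h, if_false]
    omega

/-- The sign comes from `reflection` being odd. -/
theorem alternation_fullFlagTensor {n : ℕ} {w : (Fin (n + 1) → X) → U}
    (hw : ∀ (v : Fin (n + 1) → X) (σ : Equiv.Perm (Fin (n + 1))), w (fun a => v (σ a)) = w v)
    (x : Fin ((n + 1) + (n + 1)) → X) :
    ∑ π : Equiv.Perm (Fin ((n + 1) + (n + 1))), ((Equiv.Perm.sign π : ℤ) : ZHalf) •
        fullFlagTensor w (fun a => x (π (Fin.castAdd (n + 1) a)))
          (fun a => x (π (Fin.natAdd (n + 1) a))) =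
      -∑ π : Equiv.Perm (Fin ((n + 1) + (n + 1))), ((Equiv.Perm.sign π : ℤ) : ZHalf) •
        PiTensorProduct.tprod ZHalf fun k : Fin (n + 1) =>
          w fun a : Fin (n + 1) => x (π ⟨k + a, by omega⟩) := by
  rw [← Equiv.sum_comp (Equiv.mulRight (reflection n)), ← Finset.sum_neg_distrib]
  refine Finset.sum_congr rfl fun π _ => ?_
  simp only [Equiv.coe_mulRight, map_mul, sign_reflection, Equiv.Perm.mul_apply,
    fullFlagTensor_reflection hw (fun i => x (π i))]
  simp

end

section

theorem UnitsHalf.map_uclass {A B : Type*} [CommRing A] [CommRing B] (f : A →+* B) {x : A}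
    (hx : IsUnit x) : UnitsHalf.map f (uclass x) = uclass (f x) := by
  obtain ⟨x, rfl⟩ := hx
  rw [uclass_unit, UnitsHalf.map_unitClass, ← uclass_unit]
  rfl

theorem ringHom_vol {A B : Type*} [CommRing A] [CommRing B] (f : A →+* B) {d : ℕ}
    (v : Fin d → Vec A d) : f (vol v) = vol (fun i k => f (v i k)) := by
  unfold vol
  rw [RingHom.map_det]
  rfl

/-- The identity over an arbitrary field, for vectors in general position. -/
theorem tensorId_nuIter_motivicElement {F : Type*} [Field F] (n : ℕ) {ω : F} (hω : ω ≠ 0)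
    {l : Fin ((n + 1) + (n + 1)) → Vec F (n + 1)} (hl : Generic l) :
    tensorId (nuIter F n) (motivicElement n ω l) =
      ((-1 : ZHalf) ^ (n + 1) * ((n + 1).factorial : ZHalf) ^ 2) • tateElement (n + 1) ω l := by
  let w : (Fin (n + 1) → Vec F (n + 1)) → UnitsHalf F := fun v => uclass (ω * vol v)
  have hw : ∀ (v : Fin (n + 1) → Vec F (n + 1)) (σ : Equiv.Perm (Fin (n + 1))),
      w (fun a => v (σ a)) = w v := by
    intro v σ
    have h : vol (fun a => v (σ a)) = Equiv.Perm.sign σ * vol v :=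
      Matrix.det_permute σ (Matrix.of v)
    simp only [w, h]
    rcases Int.units_eq_one_or (Equiv.Perm.sign σ) with h | h <;> simp [h, uclass_neg]
  have hc : ∀ v : Fin (n + 1) → Vec F (n + 1), vol v ≠ 0 → uclass (vol v) = -uclass ω + w v := by
    intro v hv
    simp only [w, uclass_mul hω.isUnit hv.isUnit, neg_add_cancel_left]
  have hg : ∀ π : Equiv.Perm (Fin ((n + 1) + (n + 1))),
      Generic (Sum.elim (fun a => l (π (Fin.castAdd (n + 1) a)))
        (fun a => l (π (Fin.natAdd (n + 1) a)))) := by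
    intro π
    convert hl.comp (f := fun s => π (finSumFinEquiv s))
      (π.injective.comp finSumFinEquiv.injective) using 1
    ext (a | a) <;> rfl
  have h1 : tensorId (nuIter F n) (motivicElement n ω l) = (-1 : ZHalf) ^ n •
      ∑ π : Equiv.Perm (Fin ((n + 1) + (n + 1))), ((Equiv.Perm.sign π : ℤ) : ZHalf) •
        snoc (UnitsHalf F) n (flagSum w (fun a => l (π (Fin.castAdd (n + 1) a)))
          (fun a => l (π (Fin.natAdd (n + 1) a)))) (w (fun a => l (π (Fin.natAdd (n + 1) a)))) := by
    rw [motivicElement, map_sum, Finset.smul_sum]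
    refine Finset.sum_congr rfl fun π _ => ?_
    have h2 := nuIter_br n id w hw (-uclass ω) hc (fun a => l (π (Fin.castAdd (n + 1) a)))
      (fun a => l (π (Fin.natAdd (n + 1) a))) (hg π)
    simp only [id] at h2
    rw [map_zsmul, tensorId_tmul, h2, map_smul, LinearMap.smul_apply,
      ← Int.cast_smul_eq_zsmul ZHalf, smul_comm]
  rw [h1, alternation_snoc_flagSum hw, alternation_fullFlagTensor hw, tateElement, smul_neg,
    smul_neg, smul_smul, pow_succ (-1 : ZHalf), mul_neg_one, neg_mul, neg_smul]

end

end GrassmannianPolylog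
end

theorem theorem4p2 (n : ℕ) (ω : (GrassmannianPolylog.OG (n + 1))ˣ) :
    GrassmannianPolylog.tensorId
        (GrassmannianPolylog.nuIter (GrassmannianPolylog.QG (n + 1)) n)
        (GrassmannianPolylog.motivicElement n
          (algebraMap (GrassmannianPolylog.OG (n + 1)) (GrassmannianPolylog.QG (n + 1)) ω)
          (GrassmannianPolylog.ratVec (n + 1))) =
      ((-1 : GrassmannianPolylog.ZHalf) ^ (n + 1) *
          ((n + 1).factorial : GrassmannianPolylog.ZHalf) ^ 2) •
        PiTensorProduct.map
          (fun _ => GrassmannianPolylog.UnitsHalf.map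
            (algebraMap (GrassmannianPolylog.OG (n + 1)) (GrassmannianPolylog.QG (n + 1))))
          (GrassmannianPolylog.tateElement (n + 1) (ω : GrassmannianPolylog.OG (n + 1))
            (GrassmannianPolylog.univVec (n + 1))) := by
  open GrassmannianPolylog in
  rw [tensorId_nuIter_motivicElement n (ω.isUnit.map _).ne_zero (generic_ratVec (n + 1))]
  congr 1
  simp only [tateElement, map_sum, map_smul, PiTensorProduct.map_tprod]
  refine Finset.sum_congr rfl fun σ _ => ?_
  congr 2
  funext k
  have hinj : Function.Injective fun a : Fin (n + 1) =>
      σ (⟨k + a, by omega⟩ : Fin ((n + 1) + (n + 1))) := fun a b h => by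
    simpa [Fin.ext_iff] using h
  have hu := ω.isUnit.mul (isUnit_vol_univVec (n + 1) ⟨_, hinj⟩)
  refine Eq.trans ?_ (UnitsHalf.map_uclass _ hu).symm
  rw [map_mul, ringHom_vol]
  rfl
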